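/- Let $n,N\ge 0$ be integers and let $\mathsf A_1,\dots,\mathsf A_n$ be parties. Consider a quantum network built from finitely many resources $\xi_1,\dots,\xi_N$, all systems being finite-dimensional, where each resource is of one of the following kinds: (a) $\xi_s=|\psi\rangle\langle\psi|$ with $|\psi\rangle$ an arbitrary pure state of finitely many subsystems (of arbitrary finite dimensions), all of which are held by two distinct parties $\mathsf A_i,\mathsf A_j$, distributed between them in any way; (b) $\xi_s=|\phi\rangle\langle\phi|$ with $|\phi\rangle=\cos\varphi\,|0\rangle^{\otimes m}+\sin\varphi\,|1\rangle^{\otimes m}$ a generalized GHZ state of $m\ge 3$ qubits, $\varphi\in\mathbb R$, whose qubits are distributed in any way among the parties (in particular among two parties only, or among three or more); (c) $\xi_s=\delta(\vartheta)=\cos^2\vartheta\,|00\rangle\langle 00|+\sin^2\vartheta\,|11\rangle\langle 11|$, $\vartheta\in\mathbb R$, a two-qubit marginal of a generalized GHZ state, one qubit being held by $\mathsf A_i$ and the other by $\mathsf A_j$, $i\ne j$. The Hilbert space of $\mathsf A_i$ is the tensor product of all subsystems that $\mathsf A_i$ holds. Each party may apply a local unitary operation $U_i$ to it, so the total state is $$\rho_{\mathsf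 A_1\cdots\mathsf A_n}=\Big(\bigotimes_i U_i\Big)\Big(\bigotimes_{s=1}^N\xi_s\Big)\Big(\bigotimes_i U_i\Big)^\dagger .$$ Let $\rho_{\mathsf A_i\mathsf A_j}$ denote its marginals and $\overline{\mathsf A_i}$ all parties except $\mathsf A_i$. For a bipartite pure state put $\mathcal E(|\phi\rangle_{\mathsf A\mathsf B})=-\mathrm{Tr}(\rho_{\mathsf A}\log_2\rho_{\mathsf A})$ and, for $\alpha>0$, $\alpha\ne1$, $\mathcal R_\alpha(|\phi\rangle_{\mathsf A\mathsf B})=\frac1{1-\alpha}\log_2\mathrm{Tr}(\rho_{\mathsf A}^\alpha)$, where $\rho_{\mathsf A}=\mathrm{Tr}_{\mathsf B}|\phi\rangle\langle\phi|$. Extend both to mixed states by the convex roof $\mathcal Q(\rho_{\mathsf A\mathsf B})=\inf\sum_kp_k\mathcal Q(|\phi_k\rangle_{\mathsf A\mathsf B})$, the infimum being over all finite decompositions $\rho_{\mathsf A\mathsf B}=\sum_kp_k|\phi_k\rangle\langle\phi_k|$ into pure states with $p_k\ge0$, $\sum_kp_k=1$. ($\mathcal E$ is the entanglement of formation and $\mathcal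 R_\alpha$ the Rényi-$\alpha$ entanglement.) Then for every $i$, for $\mathcal Q=\mathcal E$ and for $\mathcal Q=\mathcal R_\alpha$ with any $\alpha>0$, $\alpha\neq1$, $$\mathcal Q_{\mathsf A_i|\overline{\mathsf A_i}}(\rho_{\mathsf A_1\cdots\mathsf A_n})\;\ge\;\sum_{j=1,\,j\ne i}^n\mathcal Q_{\mathsf A_i|\mathsf A_j}(\rho_{\mathsf A_i\mathsf A_j}).$$ -/

import Mathlib

namespace QNetwork

noncomputable section

/-! ## Bipartite entanglement measures

A vector of `ℂ^A ⊗ ℂ^B` is given by its coordinates `φ : A × B → ℂ` in the product basis. -/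

/-- The operator `|ψ⟩⟨ψ|`. -/
def ketBra {X : Type} (ψ : X → ℂ) : Matrix X X ℂ :=
  Matrix.vecMulVec ψ (star ψ)

/-- `ψ` is a unit vector for the Hilbert space norm. -/
def IsUnitVec {X : Type} [Fintype X] (ψ : X → ℂ) : Prop :=
  ∑ x, ‖ψ x‖ ^ 2 = 1

/-- The partial trace `Tr_B` of an operator on `ℂ^A ⊗ ℂ^B`. -/
def traceRight {A B : Type} [Fintype B] (ρ : Matrix (A × B) (A × B) ℂ) : Matrix A A ℂ :=
  Matrix.of fun a a' => ∑ b, ρ (a, b) (a', b)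

theorem isHermitian_reduced {A B : Type} [Fintype B] (φ : A × B → ℂ) :
    (traceRight (ketBra φ)).IsHermitian := by
  ext a a'
  simp [traceRight, ketBra, Matrix.vecMulVec_apply, mul_comm]

/-- The von Neumann entropy `S(ρ) = -Tr (ρ log₂ ρ)`, computed from the eigenvalues of `ρ`
(here `0 log₂ 0 = 0`). -/
def vonNeumannEntropy {A : Type} [Fintype A] [DecidableEq A] {ρ : Matrix A A ℂ}
    (hρ : ρ.IsHermitian) : ℝ :=
  -∑ a, hρ.eigenvalues a * Real.logb 2 (hρ.eigenvalues a)

/-- The Rényi-`α` entropy `S_α(ρ) = (1 - α)⁻¹ log₂ Tr (ρ ^ α)`, computed from the eigenvalues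
of `ρ`. -/
def renyiEntropy (α : ℝ) {A : Type} [Fintype A] [DecidableEq A] {ρ : Matrix A A ℂ}
    (hρ : ρ.IsHermitian) : ℝ :=
  1 / (1 - α) * Real.logb 2 (∑ a, hρ.eigenvalues a ^ α)

/-- The set of ensemble averages `∑ p_k E(|φ_k⟩)` over all decompositions
`ρ = ∑ p_k |φ_k⟩⟨φ_k|` of `ρ` into finitely many pure states, with `p_k ≥ 0`, `∑ p_k = 1`. -/
def ensembleAverages {X : Type} [Fintype X] (E : (X → ℂ) → ℝ) (ρ : Matrix X X ℂ) : Set ℝ :=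
  {v | ∃ (r : ℕ) (p : Fin r → ℝ) (φ : Fin r → X → ℂ),
    (∀ k, 0 ≤ p k) ∧ ∑ k, p k = 1 ∧ (∀ k, IsUnitVec (φ k)) ∧
    ρ = ∑ k, (p k : ℂ) • ketBra (φ k) ∧ v = ∑ k, p k * E (φ k)}

/-- The convex-roof extension to mixed states of a function `E` of pure states. -/
def convexRoof {X : Type} [Fintype X] (E : (X → ℂ) → ℝ) (ρ : Matrix X X ℂ) : ℝ :=
  sInf (ensembleAverages E ρ)

/-- The entanglement of formation, with respect to the cut `A | B`. -/
def eof {A B : Type} [Fintype A] [Fintype B] [DecidableEq A]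
    (ρ : Matrix (A × B) (A × B) ℂ) : ℝ :=
  convexRoof (fun φ => vonNeumannEntropy (isHermitian_reduced φ)) ρ

/-- The Rényi-`α` entanglement, with respect to the cut `A | B`. -/
def renyiEntanglement (α : ℝ) {A B : Type} [Fintype A] [Fintype B] [DecidableEq A]
    (ρ : Matrix (A × B) (A × B) ℂ) : ℝ :=
  convexRoof (fun φ => renyiEntropy α (isHermitian_reduced φ)) ρ

/-! ## Resources of a network with parties `Fin n` -/

/-- The generalized GHZ vector `cos φ |0⟩^{⊗m} + sin φ |1⟩^{⊗m}` of `m` qubits. -/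
def ghzVec (m : ℕ) (φ : ℝ) : (Fin m → Fin 2) → ℂ := fun c =>
  (if c = fun _ => 0 then (Real.cos φ : ℂ) else 0) +
    (if c = fun _ => 1 then (Real.sin φ : ℂ) else 0)

/-- The two-qubit state `cos² ϑ |00⟩⟨00| + sin² ϑ |11⟩⟨11|`, the two-qubit marginal of a
generalized GHZ state. -/
def deltaState (ϑ : ℝ) : Matrix (Fin 2 → Fin 2) (Fin 2 → Fin 2) ℂ :=
  ((Real.cos ϑ ^ 2 : ℝ) : ℂ) • ketBra (Pi.single (fun _ => 0) 1) +
    ((Real.sin ϑ ^ 2 : ℝ) : ℂ) • ketBra (Pi.single (fun _ => 1) 1)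

/-- A state of finitely many subsystems (of arbitrary finite dimensions), each of which is
held by one of the `n` parties. -/
structure Source (n : ℕ) where
  size : ℕ
  dim : Fin size → ℕ
  owner : Fin size → Fin n
  state : Matrix (∀ p, Fin (dim p)) (∀ p, Fin (dim p)) ℂ

/-- The resources from which a network is built. -/
inductive Resource (n : ℕ) where
  /-- An arbitrary multipartite pure state `ψ` whose subsystems are held by the two distinct
  parties `i` and `j`. -/
  | twoPartyPure (i j : Fin n) (hij : i ≠ j) (m : ℕ) (d : Fin m → ℕ) (own : Fin m → Fin n)
      (hown : ∀ p, own p = i ∨ own p = j) (ψ : (∀ p, Fin (d p)) → ℂ) (hψ : IsUnitVec ψ)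
  /-- A generalized GHZ state of `m ≥ 3` qubits, distributed in any way among the parties:
  among exactly two of them, or among more. -/
  | ghz (m : ℕ) (hm : 3 ≤ m) (φ : ℝ) (own : Fin m → Fin n)
  /-- A two-qubit marginal of a generalized GHZ state, shared by two distinct parties `i`
  and `j`, the other qubits of the GHZ state being outside the network. -/
  | delta (i j : Fin n) (hij : i ≠ j) (ϑ : ℝ)

/-- The state of a resource, with the parties that hold its subsystems. -/
def Resource.toSource {n : ℕ} : Resource n → Source n
  | .twoPartyPure _ _ _ m d own _ ψ _ => ⟨m, d, own, ketBra ψ⟩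
  | .ghz m _ φ own => ⟨m, fun _ => 2, own, ketBra (ghzVec m φ)⟩
  | .delta i j _ ϑ => ⟨2, fun _ => 2, ![i, j], deltaState ϑ⟩

/-! ## The state of a network -/

section Network

variable {n N : ℕ} (R : Fin N → Resource n)

/-- All subsystems of all resources of the network. -/
abbrev Particle : Type := Σ s : Fin N, Fin (R s).toSource.size

/-- The index set of the product basis of the Hilbert space of the party `i`, the tensor
product of all subsystems that this party holds. -/
abbrev LocalBasis (i : Fin n) : Type :=
  ∀ q : {q : Particle R // (R q.1).toSource.owner q.2 = i}, Fin ((R q.1.1).toSource.dim q.1.2)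

/-- The part of a basis index of the whole network that belongs to the resource `s`. -/
def resourceIndex (x : ∀ i, LocalBasis R i) (s : Fin N) :
    ∀ p, Fin ((R s).toSource.dim p) :=
  fun p => x ((R s).toSource.owner p) ⟨⟨s, p⟩, rfl⟩

/-- The tensor product of the states of all resources, as an operator on the tensor product
of the Hilbert spaces of the parties. -/
def sourceState : Matrix (∀ i, LocalBasis R i) (∀ i, LocalBasis R i) ℂ :=
  Matrix.of fun x y => ∏ s, (R s).toSource.state (resourceIndex R x s) (resourceIndex R y s)

variable {R}

/-- The tensor product `U_1 ⊗ ⋯ ⊗ U_n` of local unitary operations of the parties. -/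
def localUnitary (U : ∀ i, Matrix.unitaryGroup (LocalBasis R i) ℂ) :
    Matrix (∀ i, LocalBasis R i) (∀ i, LocalBasis R i) ℂ :=
  Matrix.of fun x y => ∏ i, (U i : Matrix (LocalBasis R i) (LocalBasis R i) ℂ) (x i) (y i)

/-- The total state `ρ_{A_1 ⋯ A_n}` of the network after the local unitary operations `U`
(the tensor product of the resources itself is the case `U = 1`). -/
def networkState (U : ∀ i, Matrix.unitaryGroup (LocalBasis R i) ℂ) :
    Matrix (∀ i, LocalBasis R i) (∀ i, LocalBasis R i) ℂ :=
  localUnitary U * sourceState R * (localUnitary U).conjTranspose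

end Network

/-! ## Cuts and marginals of an `n`-party state -/

section Marginals

variable {n : ℕ} {L : Fin n → Type}

/-- The state `ρ_{A_1 ⋯ A_n}` as a bipartite state of the party `i` and all other parties. -/
def cutState (ρ : Matrix (∀ k, L k) (∀ k, L k) ℂ) (i : Fin n) :
    Matrix (L i × ∀ k : {k // k ≠ i}, L k) (L i × ∀ k : {k // k ≠ i}, L k) ℂ :=
  ρ.submatrix (Equiv.piSplitAt i L).symm (Equiv.piSplitAt i L).symm

/-- The reduced state `ρ_{A_i A_j}` of the parties `i` and `j ≠ i`. -/
def pairState [∀ k, Fintype (L k)] (ρ : Matrix (∀ k, L k) (∀ k, L k) ℂ) (i : Fin n)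
    (j : {k // k ≠ i}) : Matrix (L i × L j) (L i × L j) ℂ :=
  Matrix.of fun x y => ∑ r : ∀ k : {k : {k // k ≠ i} // k ≠ j}, L k,
    cutState ρ i (x.1, (Equiv.piSplitAt j fun k : {k // k ≠ i} => L k).symm (x.2, r))
      (y.1, (Equiv.piSplitAt j fun k : {k // k ≠ i} => L k).symm (y.2, r))

end Marginals

end

end QNetwork

namespace QNetwork

noncomputable section

open Matrix Polynomial
open scoped Kronecker ComplexOrder

/-! Local unitaries change neither side, and the product of the resources splits, across every cut
and for every pair marginal, into a tensor product over the resources. So it suffices to bound each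
resource separately by numbers that add up: an upper bound `c s j` for each pair and a lower bound
`e s` for the cut, with `∑ j, c s j ≤ e s` (`Resource.exists_bounds`).

Upper bounds add because a product of ensembles is an ensemble and entropy is additive on product
vectors. Lower bounds are the delicate side, since a convex roof need not be superadditive. They are
carried by `DiagonalEnsemble`: vectors `v c` for the state such that `Tr_B |v c⟩⟨v c'|` vanishes for
`c ≠ c'` and, for `c = c'`, is diagonal in one common basis with entropy `e`. Every pure state in
any decomposition is a superposition `∑ a c • v c`; its reduced spectrum is the mixture of the
spectra `d c` with weights `‖a c‖ ^ 2`, so its entropy is at least `e` (`DiagonalEnsemble.le_roof`).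
This structure is stable under tensor products, with `e` additive.

For one resource the bounds are as follows. A pure state is a one-member diagonal ensemble, with `e`
its entanglement across the cut. If `i` and `j` hold all of it, with `j` holding a part, the pair
state is that same pure state; this happens for at most one `j`. For any other `j` the pair state is
separable: a missing GHZ qubit reveals the branch, and in a two-party state `i` or `j` holds
nothing. For a delta resource all bounds are zero: it is a mixture of product vectors, and a qubit
outside `i` labels them orthogonally. -/

/-! ## Spectral entropies -/

/-- An entropy of finite probability vectors, with the properties that the von Neumann and the
Rényi entropies share. -/
structure SpectralEntropy where
  H : ∀ {ι : Type} [Fintype ι], (ι → ℝ) → ℝ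
  congr : ∀ {ι κ : Type} [Fintype ι] [Fintype κ] (d : ι → ℝ) (d' : κ → ℝ),
    Finset.univ.val.map d = Finset.univ.val.map d' → H d = H d'
  nonneg : ∀ {ι : Type} [Fintype ι] (d : ι → ℝ), (∀ a, 0 ≤ d a) → ∑ a, d a = 1 → 0 ≤ H d
  eq_zero : ∀ {ι : Type} [Fintype ι] (d : ι → ℝ), (∀ a, d a * d a = d a) → ∑ a, d a = 1 → H d = 0
  pi : ∀ {S : Type} [Fintype S] [DecidableEq S] {ι : S → Type} [∀ s, Fintype (ι s)]
    (d : ∀ s, ι s → ℝ), (∀ s a, 0 ≤ d s a) → (∀ s, ∑ a, d s a = 1) →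
      H (fun x : ∀ s, ι s => ∏ s, d s (x s)) = ∑ s, H (d s)
  -- Only distributions of equal entropy are mixed: Rényi entropies need not be concave for `α > 1`,
  -- but this weaker property holds for all `α > 0`.
  mix : ∀ {K ι : Type} [Fintype K] [Fintype ι] (p : K → ℝ) (q : K → ι → ℝ) (h : ℝ),
    (∀ c, 0 ≤ p c) → ∑ c, p c = 1 → (∀ c a, 0 ≤ q c a) → (∀ c, ∑ a, q c a = 1) →
      (∀ c, H (q c) = h) → h ≤ H (fun a => ∑ c, p c * q c a)

theorem sum_comp_congr {ι κ : Type} [Fintype ι] [Fintype κ] {d : ι → ℝ} {d' : κ → ℝ}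
    (h : Finset.univ.val.map d = Finset.univ.val.map d') (f : ℝ → ℝ) :
    ∑ a, f (d a) = ∑ a, f (d' a) := by
  have := congrArg (fun m => (m.map f).sum) h
  simp only [Multiset.map_map] at this
  exact this

theorem le_one_of_sum_eq_one {ι : Type} [Fintype ι] {d : ι → ℝ} (h0 : ∀ a, 0 ≤ d a)
    (h1 : ∑ a, d a = 1) (a : ι) : d a ≤ 1 :=
  h1 ▸ Finset.single_le_sum (fun b _ => h0 b) (Finset.mem_univ a)

theorem prod_mul_logb_prod {S : Type} [Fintype S] (f : S → ℝ) :
    (∏ s, f s) * Real.logb 2 (∏ s, f s) = ∑ t, (∏ s, f s) * Real.logb 2 (f t) := by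
  by_cases h : ∏ s, f s = 0
  · simp [h]
  · rw [Real.logb_prod _ _ fun s hs => fun h0 => h (Finset.prod_eq_zero hs h0), Finset.mul_sum]

/-- The expectation under a product distribution of a function of one coordinate: `g` is absorbed
into the factor `t`, and every other factor sums to one. -/
theorem sum_pi_prod_mul {S : Type} [Fintype S] [DecidableEq S] {ι : S → Type}
    [∀ s, Fintype (ι s)] (d : ∀ s, ι s → ℝ) (hd : ∀ s, ∑ a, d s a = 1) (t : S) (g : ι t → ℝ) :
    ∑ x : ∀ s, ι s, (∏ s, d s (x s)) * g (x t) = ∑ a, d t a * g a := by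
  have key : ∀ x : ∀ s, ι s, (∏ s, d s (x s)) * g (x t) =
      ∏ s, d s (x s) * (if h : s = t then g (h ▸ x s) else 1) := by
    intro x
    rw [Finset.prod_mul_distrib]
    congr 1
    rw [Finset.prod_eq_single t]
    · simp
    · intro s _ hs
      simp [hs]
    · simp
  simp_rw [key]
  rw [← Fintype.prod_sum fun s a => d s a * (if h : s = t then g (h ▸ a) else 1),
    Finset.prod_eq_single t]
  · simp
  · intro s _ hs
    simp [hs, hd]
  · simp

/-- The von Neumann entropy as a spectral entropy. -/
def vonNeumann : SpectralEntropy where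
  H d := -∑ a, d a * Real.logb 2 (d a)
  congr d d' h := by
    rw [sum_comp_congr h fun t => t * Real.logb 2 t]
  nonneg d h0 h1 := by
    rw [neg_nonneg]
    refine Finset.sum_nonpos fun a _ => mul_nonpos_of_nonneg_of_nonpos (h0 a) ?_
    exact Real.logb_nonpos (by norm_num) (h0 a) (le_one_of_sum_eq_one h0 h1 a)
  eq_zero d hd _ := by
    rw [neg_eq_zero]
    refine Finset.sum_eq_zero fun a _ => ?_
    rcases IsIdempotentElem.iff_eq_zero_or_one.mp (hd a) with h | h <;> simp [h]
  pi d h0 h1 := by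
    simp_rw [prod_mul_logb_prod]
    rw [Finset.sum_comm, ← Finset.sum_neg_distrib]
    refine Finset.sum_congr rfl fun t _ => ?_
    rw [sum_pi_prod_mul d h1 t fun a => Real.logb 2 (d t a)]
  mix p q h hp hp1 hq hq1 hH := by
    have hlog : ∀ t : ℝ, t * Real.logb 2 t = -(Real.negMulLog t / Real.log 2) := by
      intro t
      rw [Real.negMulLog, Real.logb]
      ring
    have hL : 0 < Real.log 2 := Real.log_pos (by norm_num)
    simp_rw [hlog, Finset.sum_neg_distrib, neg_neg, ← Finset.sum_div] at hH ⊢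
    have hH' : ∀ c, ∑ a, Real.negMulLog (q c a) = h * Real.log 2 := fun c =>
      (div_eq_iff hL.ne').mp (hH c)
    rw [le_div_iff₀ hL]
    calc h * Real.log 2 = ∑ c, p c * ∑ a, Real.negMulLog (q c a) := by
          simp_rw [hH', ← Finset.sum_mul, hp1, one_mul]
      _ = ∑ a, ∑ c, p c * Real.negMulLog (q c a) := by
          simp_rw [Finset.mul_sum]
          exact Finset.sum_comm
      _ ≤ _ := Finset.sum_le_sum fun a _ =>
          Real.concaveOn_negMulLog.le_map_sum (fun c _ => hp c) hp1 fun c _ => hq c a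

theorem exists_pos_of_sum_eq_one {ι : Type} [Fintype ι] {d : ι → ℝ} (h0 : ∀ a, 0 ≤ d a)
    (h1 : ∑ a, d a = 1) : ∃ a, 0 < d a := by
  by_contra! h
  have : ∑ a, d a = 0 := Finset.sum_eq_zero fun a _ => le_antisymm (h a) (h0 a)
  linarith

theorem sum_rpow_pos {ι : Type} [Fintype ι] {d : ι → ℝ} (h0 : ∀ a, 0 ≤ d a)
    (h1 : ∑ a, d a = 1) (α : ℝ) : 0 < ∑ a, d a ^ α := by
  obtain ⟨a, ha⟩ := exists_pos_of_sum_eq_one h0 h1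
  exact Finset.sum_pos' (fun b _ => Real.rpow_nonneg (h0 b) α)
    ⟨a, Finset.mem_univ a, Real.rpow_pos_of_pos ha α⟩

/-- The Rényi entropies as spectral entropies. -/
def renyi (α : ℝ) (hα : 0 < α) (hα1 : α ≠ 1) : SpectralEntropy where
  H d := 1 / (1 - α) * Real.logb 2 (∑ a, d a ^ α)
  congr d d' h := by
    rw [sum_comp_congr h fun t => t ^ α]
  nonneg d h0 h1 := by
    rcases lt_or_gt_of_ne hα1 with h | h
    · refine mul_nonneg (by have := sub_pos.mpr h; positivity) (Real.logb_nonneg (by norm_num) ?_)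
      rw [← h1]
      exact Finset.sum_le_sum fun a _ =>
        Real.self_le_rpow_of_le_one (h0 a) (le_one_of_sum_eq_one h0 h1 a) h.le
    · refine mul_nonneg_of_nonpos_of_nonpos
        (one_div_nonpos.mpr (by linarith)) (Real.logb_nonpos (by norm_num)
          (Finset.sum_nonneg fun a _ => Real.rpow_nonneg (h0 a) α) ?_)
      rw [← h1]
      exact Finset.sum_le_sum fun a _ =>
        Real.rpow_le_self_of_le_one (h0 a) (le_one_of_sum_eq_one h0 h1 a) h.le
  eq_zero d hd h1 := by
    have : ∀ a, d a ^ α = d a := by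
      intro a
      rcases IsIdempotentElem.iff_eq_zero_or_one.mp (hd a) with h | h <;> simp [h, hα.ne']
    simp [this, h1]
  pi d h0 h1 := by
    have : ∀ x : ∀ s, _, (∏ s, d s (x s)) ^ α = ∏ s, d s (x s) ^ α := fun x =>
      (Real.finsetProd_rpow _ _ (fun s _ => h0 s (x s)) α).symm
    simp_rw [this]
    rw [← Fintype.prod_sum fun s a => d s a ^ α,
      Real.logb_prod _ _ fun s _ => (sum_rpow_pos (h0 s) (h1 s) α).ne', Finset.mul_sum]
  mix p q h hp hp1 hq hq1 hH := by
    have hα' : 1 - α ≠ 0 := sub_ne_zero.mpr hα1.symm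
    -- Equal entropies mean equal power sums, so the logarithm is removed before mixing.
    have hT : ∀ c, ∑ a, q c a ^ α = 2 ^ ((1 - α) * h) := by
      intro c
      rw [← hH c, ← mul_assoc, mul_one_div_cancel hα', one_mul,
        Real.rpow_logb (by norm_num) (by norm_num) (sum_rpow_pos (hq c) (hq1 c) α)]
    have hsum : ∑ a, ∑ c, p c * q c a ^ α = 2 ^ ((1 - α) * h) := by
      rw [Finset.sum_comm]
      simp_rw [← Finset.mul_sum, hT, ← Finset.sum_mul, hp1, one_mul]
    have hmix : 0 < ∑ a, (∑ c, p c * q c a) ^ α := by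
      refine sum_rpow_pos (fun a => Finset.sum_nonneg fun c _ => mul_nonneg (hp c) (hq c a)) ?_ α
      rw [Finset.sum_comm]
      simp_rw [← Finset.mul_sum, hq1, mul_one, hp1]
    have hh : h = 1 / (1 - α) * Real.logb 2 (2 ^ ((1 - α) * h)) := by
      rw [Real.logb_rpow (by norm_num) (by norm_num)]
      field_simp
    rw [hh]
    -- At `α = 1` the power function turns from concave to convex exactly when `1 / (1 - α)` changes
    -- sign, so the inequality has the same direction in both cases.
    rcases lt_or_gt_of_ne hα1 with h' | h'
    · refine mul_le_mul_of_nonneg_left ?_ (one_div_nonneg.mpr (by linarith))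
      refine Real.logb_le_logb_of_le (by norm_num) (by positivity) ?_
      rw [← hsum]
      exact Finset.sum_le_sum fun a _ =>
        (Real.concaveOn_rpow hα.le h'.le).le_map_sum (fun c _ => hp c) hp1 fun c _ => hq c a
    · refine mul_le_mul_of_nonpos_left ?_ (one_div_nonpos.mpr (by linarith))
      refine Real.logb_le_logb_of_le (by norm_num) hmix ?_
      rw [← hsum]
      exact Finset.sum_le_sum fun a _ =>
        (convexOn_rpow h'.le).map_sum_le (fun c _ => hp c) hp1 fun c _ => hq c a

/-- The multiset of eigenvalues of `ρ` is the family `d`. -/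
def HasSpectrum {A ι : Type} [Fintype A] [DecidableEq A] [Fintype ι] (ρ : Matrix A A ℂ)
    (d : ι → ℝ) : Prop :=
  ρ.charpoly = ∏ a, (X - C (d a : ℂ))

theorem hasSpectrum_eigenvalues {A : Type} [Fintype A] [DecidableEq A] {ρ : Matrix A A ℂ}
    (hρ : ρ.IsHermitian) : HasSpectrum ρ hρ.eigenvalues :=
  hρ.charpoly_eq

/-- Both families are the root multiset of the same polynomial. Hence the entropy can be read off
from any diagonalization, whatever its index type. -/
theorem HasSpectrum.map_eq {A ι κ : Type} [Fintype A] [DecidableEq A] [Fintype ι] [Fintype κ]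
    {ρ : Matrix A A ℂ} {d : ι → ℝ} {d' : κ → ℝ} (h : HasSpectrum ρ d) (h' : HasSpectrum ρ d') :
    Finset.univ.val.map d = Finset.univ.val.map d' := by
  have key : ∀ {ι : Type} [Fintype ι] {d : ι → ℝ}, HasSpectrum ρ d →
      ρ.charpoly.roots = (Finset.univ.val.map d).map ((↑) : ℝ → ℂ) := by
    intro ι _ d h
    rw [h, Polynomial.roots_prod _ _ (Finset.prod_ne_zero_iff.mpr fun a _ => X_sub_C_ne_zero _)]
    simp [Multiset.bind_singleton, Multiset.map_map]
  exact Multiset.map_injective Complex.ofReal_injective ((key h).symm.trans (key h'))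

theorem hasSpectrum_conj_diagonal {A : Type} [Fintype A] [DecidableEq A] {W : Matrix A A ℂ}
    (hW : W.conjTranspose * W = 1) (d : A → ℝ) :
    HasSpectrum (W * diagonal (fun a => (d a : ℂ)) * W.conjTranspose) d := by
  rw [HasSpectrum, charpoly_mul_comm, ← mul_assoc, hW, one_mul, charpoly_diagonal]

/-! ## Pure bipartite states and their reduced states -/

theorem star_dotProduct_self {X : Type} [Fintype X] (ψ : X → ℂ) :
    star ψ ⬝ᵥ ψ = ((∑ x, ‖ψ x‖ ^ 2 : ℝ) : ℂ) := by
  simp [dotProduct, Complex.conj_mul']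

theorem isUnitVec_iff {X : Type} [Fintype X] {ψ : X → ℂ} :
    IsUnitVec ψ ↔ star ψ ⬝ᵥ ψ = 1 := by
  rw [star_dotProduct_self, IsUnitVec, Complex.ofReal_eq_one]

theorem ketBra_apply {X : Type} (ψ : X → ℂ) (x y : X) : ketBra ψ x y = ψ x * star (ψ y) := rfl

theorem ketBra_mulVec {X Y : Type} [Fintype Y] (W : Matrix X Y ℂ) (ψ : Y → ℂ) :
    ketBra (W *ᵥ ψ) = W * ketBra ψ * W.conjTranspose := by
  rw [ketBra, ketBra, mul_vecMulVec, vecMulVec_mul, star_mulVec]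

theorem ketBra_smul {X : Type} (c : ℂ) (ψ : X → ℂ) :
    ketBra (c • ψ) = (c * star c) • ketBra ψ := by
  ext x y
  simp [ketBra_apply]
  ring

theorem trace_traceRight {A B : Type} [Fintype A] [Fintype B] (ρ : Matrix (A × B) (A × B) ℂ) :
    (traceRight ρ).trace = ρ.trace := by
  simp [traceRight, Matrix.trace, Fintype.sum_prod_type]

/-- An isometry on the traced-out factor cancels inside the trace; the operator on the remaining
factor may be arbitrary. -/
theorem traceRight_kronecker_conj {A A' B B' : Type} [Fintype A] [Fintype B] [Fintype A']
    [Fintype B'] [DecidableEq B] (P : Matrix A' A ℂ) {V : Matrix B' B ℂ}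
    (hV : V.conjTranspose * V = 1) (ρ : Matrix (A × B) (A × B) ℂ) :
    traceRight ((P ⊗ₖ V) * ρ * (P ⊗ₖ V).conjTranspose) =
      P * traceRight ρ * P.conjTranspose := by
  have hV' : ∀ b b', ∑ x, V x b * star (V x b') = if b' = b then 1 else 0 := by
    intro b b'
    have := congrFun (congrFun hV b') b
    simp only [mul_apply, conjTranspose_apply, one_apply] at this
    rw [← this]
    exact Finset.sum_congr rfl fun _ _ => mul_comm _ _
  ext a a'
  simp only [traceRight, mul_apply, of_apply, conjTranspose_apply, kroneckerMap_apply,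
    Finset.sum_mul, star_mul', Finset.mul_sum]
  rw [Finset.sum_comm]
  simp_rw [Finset.sum_comm (s := (Finset.univ : Finset B')) (t := (Finset.univ : Finset (A × B)))]
  have key : ∀ z z' : A × B, ∑ b, P a z.1 * V b z.2 * ρ z z' * (star (P a' z'.1) * star (V b z'.2))
      = P a z.1 * ρ z z' * star (P a' z'.1) * (if z'.2 = z.2 then 1 else 0) := by
    intro z z'
    rw [← hV', Finset.mul_sum]
    exact Finset.sum_congr rfl fun _ _ => by ring
  simp_rw [key, Fintype.sum_prod_type, mul_ite, mul_one, mul_zero]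
  refine Finset.sum_congr rfl fun x' _ => ?_
  simp only [Finset.sum_ite_eq, Finset.mem_univ, if_true]
  rw [Finset.sum_comm]

namespace SpectralEntropy

variable (S : SpectralEntropy)

/-- The entropy of entanglement of a pure state. -/
def ent {A B : Type} [Fintype A] [Fintype B] [DecidableEq A] (φ : A × B → ℂ) : ℝ :=
  S.H (isHermitian_reduced φ).eigenvalues

theorem ent_eq {A B ι : Type} [Fintype A] [Fintype B] [DecidableEq A] [Fintype ι]
    {φ : A × B → ℂ} {d : ι → ℝ} (h : HasSpectrum (traceRight (ketBra φ)) d) : S.ent φ = S.H d :=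
  S.congr _ _ ((hasSpectrum_eigenvalues _).map_eq h)

end SpectralEntropy

theorem traceRight_ketBra {A B : Type} [Fintype B] (φ : A × B → ℂ) :
    traceRight (ketBra φ) =
      (of fun a b => φ (a, b)) * (of fun a b => φ (a, b)).conjTranspose := by
  ext a a'
  simp [traceRight, ketBra_apply, mul_apply]

theorem reduced_eigenvalues_nonneg {A B : Type} [Fintype A] [Fintype B] [DecidableEq A]
    (φ : A × B → ℂ) (a : A) : 0 ≤ (isHermitian_reduced φ).eigenvalues a := by
  have : (traceRight (ketBra φ)).PosSemidef := by
    rw [traceRight_ketBra]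
    exact posSemidef_self_mul_conjTranspose _
  exact this.eigenvalues_nonneg a

theorem trace_ketBra {X : Type} [Fintype X] (ψ : X → ℂ) :
    (ketBra ψ).trace = star ψ ⬝ᵥ ψ := by
  rw [ketBra, trace_vecMulVec, dotProduct_comm]

theorem reduced_eigenvalues_sum {A B : Type} [Fintype A] [Fintype B] [DecidableEq A]
    {φ : A × B → ℂ} (hφ : IsUnitVec φ) : ∑ a, (isHermitian_reduced φ).eigenvalues a = 1 := by
  have h := (isHermitian_reduced φ).trace_eq_sum_eigenvalues
  rw [trace_traceRight, trace_ketBra, isUnitVec_iff.mp hφ] at h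
  apply Complex.ofReal_injective
  rw [Complex.ofReal_sum, Complex.ofReal_one]
  exact h.symm

theorem exists_reduced_eq {A B : Type} [Fintype A] [Fintype B] [DecidableEq A]
    (φ : A × B → ℂ) : ∃ W : Matrix A A ℂ, W.conjTranspose * W = 1 ∧ traceRight (ketBra φ) =
      W * diagonal (fun a => ((isHermitian_reduced φ).eigenvalues a : ℂ)) * W.conjTranspose :=
  ⟨(isHermitian_reduced φ).eigenvectorUnitary,
    Unitary.coe_star_mul_self (isHermitian_reduced φ).eigenvectorUnitary,
    (isHermitian_reduced φ).spectral_theorem⟩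

namespace SpectralEntropy

variable (S : SpectralEntropy)

theorem ent_nonneg {A B : Type} [Fintype A] [Fintype B] [DecidableEq A] {φ : A × B → ℂ}
    (hφ : IsUnitVec φ) : 0 ≤ S.ent φ :=
  S.nonneg _ (reduced_eigenvalues_nonneg φ) (reduced_eigenvalues_sum hφ)

/-- The reduced operator is a multiple of `|a⟩⟨a|` of trace one, hence idempotent, so its
eigenvalues are 0 or 1. -/
theorem ent_eq_zero_of_product {A B : Type} [Fintype A] [Fintype B] [DecidableEq A]
    {φ : A × B → ℂ} (hφ : IsUnitVec φ) {a : A → ℂ} {b : B → ℂ}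
    (h : ∀ x y, φ (x, y) = a x * b y) : S.ent φ = 0 := by
  refine S.eq_zero _ (fun i => ?_) (reduced_eigenvalues_sum hφ)
  have hred : traceRight (ketBra φ) = (star b ⬝ᵥ b) • vecMulVec a (star a) := by
    ext x x'
    simp only [traceRight, ketBra_apply, of_apply, h, Matrix.smul_apply, vecMulVec_apply,
      dotProduct, Pi.star_apply, smul_eq_mul, Finset.sum_mul, star_mul']
    exact Finset.sum_congr rfl fun _ _ => by ring
  have hab : (star b ⬝ᵥ b) * (star a ⬝ᵥ a) = 1 := by
    rw [← isUnitVec_iff.mp hφ, ← trace_ketBra φ, ← trace_traceRight, hred, trace_smul,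
      trace_vecMulVec, dotProduct_comm a, smul_eq_mul]
  have hidem : traceRight (ketBra φ) * traceRight (ketBra φ) = traceRight (ketBra φ) := by
    rw [hred, smul_mul_smul_comm, vecMulVec_mul_vecMulVec, vecMulVec_smul, smul_smul,
      mul_assoc, hab, mul_one]
  set hr := isHermitian_reduced φ
  have hv := hr.mulVec_eigenvectorBasis i
  have h2 := congrArg (fun M : Matrix A A ℂ => M *ᵥ (hr.eigenvectorBasis i).ofLp) hidem
  simp only [← mulVec_mulVec, hv, mulVec_smul, smul_smul] at h2
  have hne : (hr.eigenvectorBasis i).ofLp ≠ 0 := by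
    intro h0
    exact hr.eigenvectorBasis.orthonormal.ne_zero i (by ext j; exact congrFun h0 j)
  exact smul_left_injective ℝ hne h2

theorem ent_kronecker_mulVec {A B : Type} [Fintype A] [Fintype B] [DecidableEq A]
    [DecidableEq B] {P : Matrix A A ℂ} {V : Matrix B B ℂ} (hP : P.conjTranspose * P = 1)
    (hV : V.conjTranspose * V = 1) (φ : A × B → ℂ) : S.ent ((P ⊗ₖ V) *ᵥ φ) = S.ent φ := by
  refine S.ent_eq ?_
  rw [HasSpectrum, ketBra_mulVec, traceRight_kronecker_conj P hV, charpoly_mul_comm, ← mul_assoc,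
    hP, one_mul]
  exact hasSpectrum_eigenvalues _

theorem ent_comp_prodCongr {A A' B B' : Type} [Fintype A] [Fintype A'] [Fintype B] [Fintype B']
    [DecidableEq A] [DecidableEq A'] (e : A ≃ A') (f : B ≃ B') (φ : A' × B' → ℂ) :
    S.ent (φ ∘ e.prodCongr f) = S.ent φ := by
  refine S.ent_eq ?_
  have : traceRight (ketBra (φ ∘ e.prodCongr f)) =
      (traceRight (ketBra φ)).reindex e.symm e.symm := by
    ext a a'
    simp only [traceRight, ketBra_apply, of_apply, reindex_apply, submatrix_apply,
      Function.comp_apply, Equiv.prodCongr_apply, Prod.map]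
    exact f.sum_comp fun b => φ (e a, b) * star (φ (e a', b))
  rw [HasSpectrum, this, charpoly_reindex]
  exact hasSpectrum_eigenvalues _

/-! ## Ensembles -/

/-- The convex roof of the entropy of entanglement. -/
abbrev roof {A B : Type} [Fintype A] [Fintype B] [DecidableEq A]
    (ρ : Matrix (A × B) (A × B) ℂ) : ℝ :=
  convexRoof S.ent ρ

end SpectralEntropy

theorem ensemble_mem {X K : Type} [Fintype X] [Fintype K] (E : (X → ℂ) → ℝ) {ρ : Matrix X X ℂ}
    {p : K → ℝ} {φ : K → X → ℂ} (hp : ∀ k, 0 ≤ p k) (hp1 : ∑ k, p k = 1)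
    (hφ : ∀ k, IsUnitVec (φ k)) (hρ : ρ = ∑ k, (p k : ℂ) • ketBra (φ k)) :
    ∑ k, p k * E (φ k) ∈ ensembleAverages E ρ := by
  let e := (Fintype.equivFin K).symm
  refine ⟨Fintype.card K, p ∘ e, φ ∘ e, fun k => hp _, ?_, fun k => hφ _, ?_, ?_⟩
  · rw [← hp1]
    exact e.sum_comp p
  · rw [hρ]
    exact (e.sum_comp fun k => (p k : ℂ) • ketBra (φ k)).symm
  · exact (e.sum_comp fun k => p k * E (φ k)).symm

theorem ensembleAverages_conj_subset {X : Type} [Fintype X] [DecidableEq X]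
    {E : (X → ℂ) → ℝ} {W : Matrix X X ℂ} (hW : W.conjTranspose * W = 1)
    (hE : ∀ φ, E (W *ᵥ φ) = E φ) (ρ : Matrix X X ℂ) :
    ensembleAverages E ρ ⊆ ensembleAverages E (W * ρ * W.conjTranspose) := by
  rintro v ⟨r, p, φ, hp, hp1, hφ, hρ, rfl⟩
  refine ⟨r, p, fun k => W *ᵥ φ k, hp, hp1, fun k => ?_, ?_, by simp [hE]⟩
  · rw [isUnitVec_iff, star_mulVec, ← dotProduct_mulVec, mulVec_mulVec, hW, one_mulVec]
    exact isUnitVec_iff.mp (hφ k)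
  · rw [hρ, Matrix.mul_sum, Matrix.sum_mul]
    simp [ketBra_mulVec]

theorem convexRoof_conj {X : Type} [Fintype X] [DecidableEq X] {E : (X → ℂ) → ℝ}
    {W : Matrix X X ℂ} (hW : W.conjTranspose * W = 1) (hE : ∀ φ, E (W *ᵥ φ) = E φ)
    (ρ : Matrix X X ℂ) : convexRoof E (W * ρ * W.conjTranspose) = convexRoof E ρ := by
  have hW' : W * W.conjTranspose = 1 := mul_eq_one_comm.mp hW
  refine congrArg sInf (Set.Subset.antisymm ?_ (ensembleAverages_conj_subset hW hE ρ))
  -- The reverse inclusion is the forward one for the inverse `W.conjTranspose`.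
  have := ensembleAverages_conj_subset (E := E) (W := W.conjTranspose)
    (by rwa [conjTranspose_conjTranspose])
    (fun φ => by rw [← hE, mulVec_mulVec, hW', one_mulVec]) (W * ρ * W.conjTranspose)
  have hcancel : W.conjTranspose * (W * ρ * W.conjTranspose) * W = ρ := by
    rw [mul_assoc, mul_assoc, mul_assoc, hW, mul_one, ← mul_assoc, hW, one_mul]
  rwa [conjTranspose_conjTranspose, hcancel] at this

theorem ensembleAverages_submatrix_subset {X Y : Type} [Fintype X] [Fintype Y]
    {E : (X → ℂ) → ℝ} {E' : (Y → ℂ) → ℝ} (e : X ≃ Y) (hE : ∀ φ, E (φ ∘ e) = E' φ)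
    (ρ : Matrix Y Y ℂ) : ensembleAverages E' ρ ⊆ ensembleAverages E (ρ.submatrix e e) := by
  rintro v ⟨r, p, φ, hp, hp1, hφ, hρ, rfl⟩
  refine ⟨r, p, fun k => φ k ∘ e, hp, hp1, fun k => ?_, ?_, by simp [hE]⟩
  · rw [IsUnitVec, ← hφ k]
    exact e.sum_comp fun x => ‖φ k x‖ ^ 2
  · ext x y
    simp [hρ, Matrix.sum_apply, ketBra_apply]

theorem convexRoof_submatrix {X Y : Type} [Fintype X] [Fintype Y]
    {E : (X → ℂ) → ℝ} {E' : (Y → ℂ) → ℝ} (e : X ≃ Y) (hE : ∀ φ, E (φ ∘ e) = E' φ)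
    (ρ : Matrix Y Y ℂ) : convexRoof E (ρ.submatrix e e) = convexRoof E' ρ := by
  refine congrArg sInf (Set.Subset.antisymm ?_ (ensembleAverages_submatrix_subset e hE ρ))
  have := ensembleAverages_submatrix_subset (E := E') (E' := E) e.symm
    (fun φ => by rw [← hE, Function.comp_assoc]; simp) (ρ.submatrix e e)
  simpa using this

namespace SpectralEntropy

variable (S : SpectralEntropy)

theorem roof_kronecker_conj {A B : Type} [Fintype A] [Fintype B] [DecidableEq A]
    [DecidableEq B] {P : Matrix A A ℂ} {V : Matrix B B ℂ} (hP : P.conjTranspose * P = 1)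
    (hV : V.conjTranspose * V = 1) (ρ : Matrix (A × B) (A × B) ℂ) :
    S.roof ((P ⊗ₖ V) * ρ * (P ⊗ₖ V).conjTranspose) = S.roof ρ := by
  refine convexRoof_conj ?_ (S.ent_kronecker_mulVec hP hV) ρ
  rw [conjTranspose_kronecker, ← mul_kronecker_mul, hP, hV, one_kronecker_one]

theorem roof_submatrix {A A' B B' : Type} [Fintype A] [Fintype A'] [Fintype B] [Fintype B']
    [DecidableEq A] [DecidableEq A'] (e : A ≃ A') (f : B ≃ B')
    (ρ : Matrix (A' × B') (A' × B') ℂ) :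
    S.roof (ρ.submatrix (e.prodCongr f) (e.prodCongr f)) = S.roof ρ :=
  convexRoof_submatrix _ (S.ent_comp_prodCongr e f) ρ

/-- `ρ` is an ensemble of pure states of entanglement at most `c`. -/
def HasEnsembleLE {A B : Type} [Fintype A] [Fintype B] [DecidableEq A]
    (ρ : Matrix (A × B) (A × B) ℂ) (c : ℝ) : Prop :=
  ∃ (K : Type) (_ : Fintype K) (p : K → ℝ) (φ : K → A × B → ℂ),
    (∀ k, 0 ≤ p k) ∧ ∑ k, p k = 1 ∧ (∀ k, IsUnitVec (φ k)) ∧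
    ρ = ∑ k, (p k : ℂ) • ketBra (φ k) ∧ ∀ k, S.ent (φ k) ≤ c

variable {S}

theorem HasEnsembleLE.roof_le {A B : Type} [Fintype A] [Fintype B] [DecidableEq A]
    {ρ : Matrix (A × B) (A × B) ℂ} {c : ℝ} (h : S.HasEnsembleLE ρ c) : S.roof ρ ≤ c := by
  obtain ⟨K, _, p, φ, hp, hp1, hφ, hρ, hc⟩ := h
  -- A real infimum needs a lower bound; entropies of unit vectors are nonnegative.
  refine (csInf_le ⟨0, ?_⟩ (ensemble_mem S.ent hp hp1 hφ hρ)).trans ?_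
  · rintro v ⟨r, p, φ, hp, _, hφ, _, rfl⟩
    exact Finset.sum_nonneg fun k _ => mul_nonneg (hp k) (S.ent_nonneg (hφ k))
  · calc ∑ k, p k * S.ent (φ k) ≤ ∑ k, p k * c :=
          Finset.sum_le_sum fun k _ => mul_le_mul_of_nonneg_left (hc k) (hp k)
      _ = c := by rw [← Finset.sum_mul, hp1, one_mul]

/-- Separability from unnormalized product vectors: the squared norms become the weights. -/
theorem hasEnsembleLE_zero {A B K : Type} [Fintype A] [Fintype B] [DecidableEq A]
    [Fintype K] {ρ : Matrix (A × B) (A × B) ℂ} {V : K → A × B → ℂ}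
    (hρ : ρ = ∑ k, ketBra (V k)) (h1 : ∑ k, ∑ z, ‖V k z‖ ^ 2 = 1)
    (hV : ∀ k, ∃ (a : A → ℂ) (b : B → ℂ), ∀ x y, V k (x, y) = a x * b y) :
    S.HasEnsembleLE ρ 0 := by
  set p : K → ℝ := fun k => ∑ z, ‖V k z‖ ^ 2
  have hp : ∀ k, 0 ≤ p k := fun k => Finset.sum_nonneg fun z _ => by positivity
  have hV0 : ∀ k, p k = 0 → V k = 0 := by
    intro k hk
    ext z
    have := (Finset.sum_eq_zero_iff_of_nonneg fun z _ => by positivity).mp hk z (Finset.mem_univ z)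
    simpa using this
  -- An ensemble consists of unit vectors even at weight zero, so a zero vector is replaced by the
  -- normalized member `k₀`.
  obtain ⟨k₀, hk₀⟩ := exists_pos_of_sum_eq_one hp h1
  let N : K → A × B → ℂ := fun k => ((Real.sqrt (p k) : ℂ)⁻¹) • V k
  have hN : ∀ k, p k ≠ 0 → IsUnitVec (N k) := by
    intro k hk
    simp only [IsUnitVec, N, Pi.smul_apply, norm_smul, mul_pow, ← Finset.mul_sum]
    rw [norm_inv, Complex.norm_real, Real.norm_of_nonneg (Real.sqrt_nonneg _), inv_pow,
      Real.sq_sqrt (hp k)]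
    exact inv_mul_cancel₀ hk
  have hNprod : ∀ k, ∃ (a : A → ℂ) (b : B → ℂ), ∀ x y, N k (x, y) = a x * b y := by
    intro k
    obtain ⟨a, b, hab⟩ := hV k
    exact ⟨((Real.sqrt (p k) : ℂ)⁻¹) • a, b, fun x y => by simp [N, hab, mul_assoc]⟩
  refine ⟨K, inferInstance, p, fun k => if p k = 0 then N k₀ else N k, hp, h1, fun k => ?_, ?_,
    fun k => ?_⟩
  · dsimp only
    split_ifs with hk
    · exact hN k₀ hk₀.ne'
    · exact hN k hk
  · rw [hρ]
    refine Finset.sum_congr rfl fun k _ => ?_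
    dsimp only
    split_ifs with hk
    · ext x y
      simp [hV0 k hk, hk, ketBra_apply]
    · rw [ketBra_smul, smul_smul]
      have : (p k : ℂ) * ((Real.sqrt (p k) : ℂ)⁻¹ * star (Real.sqrt (p k) : ℂ)⁻¹) = 1 := by
        have hs : ((Real.sqrt (p k) : ℝ) : ℂ) * (Real.sqrt (p k) : ℝ) = p k := by
          rw [← Complex.ofReal_mul, Real.mul_self_sqrt (hp k)]
        rw [star_inv₀, Complex.star_def, Complex.conj_ofReal, ← mul_inv, hs]
        exact mul_inv_cancel₀ (Complex.ofReal_ne_zero.mpr hk)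
      rw [this, one_smul]
  · obtain ⟨a, b, hab⟩ := hNprod k₀
    obtain ⟨a', b', hab'⟩ := hNprod k
    dsimp only
    split_ifs with hk
    · exact (S.ent_eq_zero_of_product (hN k₀ hk₀.ne') hab).le
    · exact (S.ent_eq_zero_of_product (hN k hk) hab').le

end SpectralEntropy

/-! ## Tensor products of finite families -/

/-- The tensor product of a finite family of matrices. -/
def piMat {T : Type} [Fintype T] {A A' : T → Type} (M : ∀ s, Matrix (A s) (A' s) ℂ) :
    Matrix (∀ s, A s) (∀ s, A' s) ℂ :=
  of fun x y => ∏ s, M s (x s) (y s)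

/-- The tensor product of a finite family of bipartite vectors. -/
def piVec {T : Type} [Fintype T] {A B : T → Type} (φ : ∀ s, A s × B s → ℂ) :
    (∀ s, A s) × (∀ s, B s) → ℂ :=
  fun z => ∏ s, φ s (z.1 s, z.2 s)

/-- The tensor product of a finite family of bipartite states. -/
def piState {T : Type} [Fintype T] {A B : T → Type}
    (ρ : ∀ s, Matrix (A s × B s) (A s × B s) ℂ) :
    Matrix ((∀ s, A s) × (∀ s, B s)) ((∀ s, A s) × (∀ s, B s)) ℂ :=
  of fun z w => ∏ s, ρ s (z.1 s, z.2 s) (w.1 s, w.2 s)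

section Pi

variable {T : Type} [Fintype T] {A A' A'' B : T → Type}

theorem piMat_mul [DecidableEq T] [∀ s, Fintype (A' s)]
    (M : ∀ s, Matrix (A s) (A' s) ℂ) (M' : ∀ s, Matrix (A' s) (A'' s) ℂ) :
    piMat M * piMat M' = piMat fun s => M s * M' s := by
  ext x y
  simp only [piMat, mul_apply, of_apply, ← Finset.prod_mul_distrib]
  exact (Fintype.prod_sum fun s j => M s (x s) j * M' s j (y s)).symm

theorem piMat_conjTranspose (M : ∀ s, Matrix (A s) (A' s) ℂ) :
    (piMat M).conjTranspose = piMat fun s => (M s).conjTranspose := by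
  ext x y
  simp [piMat]

theorem piMat_diagonal [∀ s, DecidableEq (A s)] [DecidableEq (∀ s, A s)]
    (d : ∀ s, A s → ℂ) :
    (piMat fun s => diagonal (d s)) = diagonal fun x => ∏ s, d s (x s) := by
  ext x y
  simp only [piMat, of_apply, diagonal_apply, Finset.prod_ite_zero, Finset.mem_univ, true_imp_iff,
    funext_iff]

theorem piMat_conjTranspose_mul_self [DecidableEq T] [∀ s, Fintype (A s)]
    [∀ s, DecidableEq (A s)] [DecidableEq (∀ s, A s)]
    {M : ∀ s, Matrix (A s) (A s) ℂ} (hM : ∀ s, (M s).conjTranspose * M s = 1) :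
    (piMat M).conjTranspose * piMat M = 1 := by
  rw [piMat_conjTranspose, piMat_mul]
  simp_rw [hM]
  simpa using piMat_diagonal (A := A) fun _ _ => 1

theorem traceRight_piVec [DecidableEq T] [∀ s, Fintype (B s)] (φ φ' : ∀ s, A s × B s → ℂ) :
    traceRight (vecMulVec (piVec φ) (star (piVec φ'))) =
      piMat fun s => traceRight (vecMulVec (φ s) (star (φ' s))) := by
  ext x y
  simp only [traceRight, piVec, piMat, of_apply, vecMulVec_apply, Pi.star_apply, star_prod,
    ← Finset.prod_mul_distrib]
  exact (Fintype.prod_sum fun s b => φ s (x s, b) * star (φ' s (y s, b))).symm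

theorem isUnitVec_piVec [DecidableEq T] [∀ s, Fintype (A s)] [∀ s, Fintype (B s)]
    {φ : ∀ s, A s × B s → ℂ} (hφ : ∀ s, IsUnitVec (φ s)) :
    IsUnitVec (piVec φ) := by
  have h : ∀ s, ∑ a, ∑ b, ‖φ s (a, b)‖ ^ 2 = 1 := fun s => by
    rw [← Fintype.sum_prod_type' fun a b => ‖φ s (a, b)‖ ^ 2]
    exact hφ s
  simp only [IsUnitVec, piVec, norm_prod, ← Finset.prod_pow, Fintype.sum_prod_type]
  calc ∑ x : ∀ s, A s, ∑ y : ∀ s, B s, ∏ s, ‖φ s (x s, y s)‖ ^ 2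
      = ∑ x : ∀ s, A s, ∏ s, ∑ b, ‖φ s (x s, b)‖ ^ 2 :=
        Finset.sum_congr rfl fun x _ => (Fintype.prod_sum fun s b => ‖φ s (x s, b)‖ ^ 2).symm
    _ = 1 := by
        rw [← Fintype.prod_sum fun s a => ∑ b, ‖φ s (a, b)‖ ^ 2]
        simp [h]

theorem piState_sum_ketBra [DecidableEq T] {K : T → Type} [∀ s, Fintype (K s)]
    {ρ : ∀ s, Matrix (A s × B s) (A s × B s) ℂ} {p : ∀ s, K s → ℝ}
    {φ : ∀ s, K s → A s × B s → ℂ} (hρ : ∀ s, ρ s = ∑ k, (p s k : ℂ) • ketBra (φ s k)) :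
    piState ρ = ∑ k : ∀ s, K s, ((∏ s, p s (k s) : ℝ) : ℂ) • ketBra (piVec fun s => φ s (k s)) := by
  ext z w
  simp only [piState, of_apply, hρ, Matrix.sum_apply, Matrix.smul_apply, ketBra_apply, piVec,
    star_prod, smul_eq_mul, Complex.ofReal_prod, ← Finset.prod_mul_distrib]
  exact Fintype.prod_sum _

theorem sum_prod_eq_one [DecidableEq T] {K : T → Type} [∀ s, Fintype (K s)] {p : ∀ s, K s → ℝ}
    (hp : ∀ s, ∑ k, p s k = 1) : ∑ k : ∀ s, K s, ∏ s, p s (k s) = 1 := by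
  rw [← Fintype.prod_sum p]
  simp [hp]

/-- The reduced state of a tensor product is the tensor product of the reduced states, diagonalized
by the product of the eigenbases; its eigenvalues are products, and the field `pi` gives additivity.
-/
theorem SpectralEntropy.ent_piVec (S : SpectralEntropy) [DecidableEq T] [∀ s, Fintype (A s)]
    [∀ s, Fintype (B s)] [∀ s, DecidableEq (A s)]
    {φ : ∀ s, A s × B s → ℂ} (hφ : ∀ s, IsUnitVec (φ s)) :
    S.ent (piVec φ) = ∑ s, S.ent (φ s) := by
  choose W hW hred using fun s => exists_reduced_eq (φ s)
  rw [S.ent_eq (d := fun x : ∀ s, A s =>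
    ∏ s, (isHermitian_reduced (φ s)).eigenvalues (x s)), S.pi _
      (fun s => reduced_eigenvalues_nonneg (φ s)) fun s => reduced_eigenvalues_sum (hφ s)]
  · rfl
  · have h := hasSpectrum_conj_diagonal (piMat_conjTranspose_mul_self hW)
      fun x : ∀ s, A s => ∏ s, (isHermitian_reduced (φ s)).eigenvalues (x s)
    have h' : traceRight (ketBra (piVec φ)) =
        piMat fun s => traceRight (ketBra (φ s)) := traceRight_piVec φ φ
    rw [h', funext hred, ← piMat_mul, ← piMat_mul, ← piMat_conjTranspose, piMat_diagonal]
    simpa only [Complex.ofReal_prod] using h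

/-- Since the bound holds for each member, not just on average, it adds up member by member. -/
theorem SpectralEntropy.HasEnsembleLE.piState {S : SpectralEntropy} [DecidableEq T]
    [∀ s, Fintype (A s)] [∀ s, Fintype (B s)] [∀ s, DecidableEq (A s)]
    {ρ : ∀ s, Matrix (A s × B s) (A s × B s) ℂ} {c : T → ℝ}
    (h : ∀ s, S.HasEnsembleLE (ρ s) (c s)) : S.HasEnsembleLE (piState ρ) (∑ s, c s) := by
  choose K fin p φ hp hp1 hφ hρ hc using h
  refine ⟨∀ s, K s, inferInstance, fun k => ∏ s, p s (k s), fun k => piVec fun s => φ s (k s),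
    fun k => Finset.prod_nonneg fun s _ => hp s _, sum_prod_eq_one hp1,
    fun k => isUnitVec_piVec fun s => hφ s _, piState_sum_ketBra hρ, fun k => ?_⟩
  rw [S.ent_piVec fun s => hφ s _]
  exact Finset.sum_le_sum fun s _ => hc s _

end Pi

/-! ## Ensembles with simultaneously diagonal reduced states -/

/-- An ensemble of vectors for `ρ` whose cross reduced operators are orthogonal and
simultaneously diagonalizable, with spectra of entropy `e`. -/
structure DiagonalEnsemble (S : SpectralEntropy) {A B : Type} [Fintype A] [Fintype B]
    [DecidableEq A] (ρ : Matrix (A × B) (A × B) ℂ) (e : ℝ) where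
  K : Type
  fintypeK : Fintype K
  decEqK : DecidableEq K
  w : K → ℝ
  v : K → A × B → ℂ
  W : Matrix A A ℂ
  d : K → A → ℝ
  w_nonneg : ∀ c, 0 ≤ w c
  w_sum : ∑ c, w c = 1
  eq_sum : ρ = ∑ c, (w c : ℂ) • ketBra (v c)
  unitary : W.conjTranspose * W = 1
  cross : ∀ c c', traceRight (vecMulVec (v c) (star (v c'))) =
    if c = c' then W * diagonal (fun a => (d c a : ℂ)) * W.conjTranspose else 0
  d_nonneg : ∀ c a, 0 ≤ d c a
  d_sum : ∀ c, ∑ a, d c a = 1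
  entropy : ∀ c, S.H (d c) = e

attribute [instance] DiagonalEnsemble.fintypeK DiagonalEnsemble.decEqK

namespace DiagonalEnsemble

variable {S : SpectralEntropy}

/-- The tensor product of diagonal ensembles. -/
def pi {T : Type} [Fintype T] [DecidableEq T] {A B : T → Type} [∀ s, Fintype (A s)]
    [∀ s, Fintype (B s)] [∀ s, DecidableEq (A s)] {ρ : ∀ s, Matrix (A s × B s) (A s × B s) ℂ}
    {e : T → ℝ} (D : ∀ s, DiagonalEnsemble S (ρ s) (e s)) :
    DiagonalEnsemble S (piState ρ) (∑ s, e s) where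
  K := ∀ s, (D s).K
  fintypeK := inferInstance
  decEqK := inferInstance
  w k := ∏ s, (D s).w (k s)
  v k := piVec fun s => (D s).v (k s)
  W := piMat fun s => (D s).W
  d k x := ∏ s, (D s).d (k s) (x s)
  w_nonneg k := Finset.prod_nonneg fun s _ => (D s).w_nonneg _
  w_sum := sum_prod_eq_one fun s => (D s).w_sum
  eq_sum := piState_sum_ketBra fun s => (D s).eq_sum
  unitary := piMat_conjTranspose_mul_self fun s => (D s).unitary
  cross c c' := by
    rw [traceRight_piVec]
    simp_rw [(D _).cross]
    split_ifs with h
    · subst h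
      simp_rw [if_true, ← piMat_mul, ← piMat_conjTranspose, piMat_diagonal, Complex.ofReal_prod]
    -- Distinct labels differ at some resource, and the cross term of that single factor vanishes.
    · obtain ⟨s, hs⟩ := Function.ne_iff.mp h
      ext x y
      simp only [piMat, of_apply, Matrix.zero_apply]
      exact Finset.prod_eq_zero (Finset.mem_univ s) (by simp [hs])
  d_nonneg k x := Finset.prod_nonneg fun s _ => (D s).d_nonneg _ _
  d_sum k := sum_prod_eq_one fun s => (D s).d_sum _
  entropy k := by
    rw [S.pi _ (fun s => (D s).d_nonneg _) fun s => (D s).d_sum _]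
    simp [(D _).entropy]

variable {A B : Type} [Fintype A] [Fintype B] [DecidableEq A] {ρ : Matrix (A × B) (A × B) ℂ}
  {e : ℝ}

/-- Orthonormality is the trace of the relation `cross`. -/
theorem star_dotProduct (D : DiagonalEnsemble S ρ e) (c c' : D.K) :
    star (D.v c) ⬝ᵥ D.v c' = if c = c' then 1 else 0 := by
  have h := congrArg Matrix.trace (D.cross c' c)
  rw [trace_traceRight, trace_vecMulVec, dotProduct_comm] at h
  rw [h]
  by_cases hc : c = c'
  · subst hc
    rw [if_pos rfl, if_pos rfl, Matrix.trace_mul_comm, ← mul_assoc, D.unitary, one_mul,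
      trace_diagonal, ← Complex.ofReal_sum, D.d_sum, Complex.ofReal_one]
  · rw [if_neg hc, if_neg (Ne.symm hc), trace_zero]

theorem isUnitVec (D : DiagonalEnsemble S ρ e) (c : D.K) : IsUnitVec (D.v c) := by
  rw [isUnitVec_iff, star_dotProduct, if_pos rfl]

/-- Interference between different `c` is killed by `cross`, so the reduced spectrum is a mixture of
the `d c`; orthonormality makes the weights `‖a c‖ ^ 2` sum to one, and `mix` applies. -/
theorem le_ent (D : DiagonalEnsemble S ρ e) {a : D.K → ℂ} {φ : A × B → ℂ}
    (hφ : φ = ∑ c, a c • D.v c) (h1 : IsUnitVec φ) : e ≤ S.ent φ := by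
  have hred : traceRight (ketBra φ) = D.W * diagonal (fun x =>
      ((∑ c, ‖a c‖ ^ 2 * D.d c x : ℝ) : ℂ)) * D.W.conjTranspose := by
    have hlin : traceRight (ketBra φ) = ∑ c, ∑ c', (a c * star (a c')) •
        traceRight (vecMulVec (D.v c) (star (D.v c'))) := by
      ext x y
      simp only [traceRight, ketBra_apply, hφ, of_apply, Matrix.sum_apply, Matrix.smul_apply,
        vecMulVec_apply, Finset.sum_apply, Pi.smul_apply, Pi.star_apply, smul_eq_mul, star_sum,
        Finset.mul_sum, Finset.sum_mul, star_mul']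
      rw [Finset.sum_comm]
      simp_rw [Finset.sum_comm (s := (Finset.univ : Finset B))]
      rw [Finset.sum_comm]
      refine Finset.sum_congr rfl fun c _ => Finset.sum_congr rfl fun c' _ =>
        Finset.sum_congr rfl fun b _ => by ring
    rw [hlin]
    simp_rw [D.cross, smul_ite, smul_zero, Finset.sum_ite_eq, Finset.mem_univ, if_true]
    have hsmul : ∀ (k : ℂ) (M : Matrix A A ℂ), k • (D.W * M * D.W.conjTranspose) =
        D.W * (k • M) * D.W.conjTranspose := fun k M => by
      rw [Matrix.mul_smul, Matrix.smul_mul]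
    simp_rw [hsmul]
    rw [← Matrix.sum_mul, ← Matrix.mul_sum]
    congr 2
    ext x y
    by_cases hxy : x = y
    · subst hxy
      simp [Matrix.sum_apply, Complex.mul_conj']
    · simp [Matrix.sum_apply, hxy]
  have hspec : HasSpectrum (traceRight (ketBra φ)) fun x => ∑ c, ‖a c‖ ^ 2 * D.d c x := by
    rw [hred]
    exact hasSpectrum_conj_diagonal D.unitary _
  rw [S.ent_eq hspec]
  refine S.mix _ _ e (fun c => by positivity) ?_ D.d_nonneg D.d_sum D.entropy
  have := isUnitVec_iff.mp h1
  rw [hφ, star_sum, sum_dotProduct] at this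
  simp_rw [dotProduct_sum, star_smul, smul_dotProduct, dotProduct_smul, D.star_dotProduct] at this
  simp only [smul_eq_mul, mul_ite, mul_one, mul_zero, Finset.sum_ite_eq, Finset.mem_univ,
    if_true, Complex.star_def, Complex.conj_mul'] at this
  exact_mod_cast this

/-- Every member of positive weight lies in the span of the `v c`. With `P` the projection onto that
span, `1 - P` annihilates `ρ`; each diagonal entry of the compressed `ρ` is a sum of nonnegative
terms, so every term vanishes. -/
theorem exists_eq_sum (D : DiagonalEnsemble S ρ e) {r : ℕ} {p : Fin r → ℝ}
    {φ : Fin r → A × B → ℂ} (hp : ∀ k, 0 ≤ p k)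
    (hρ : ρ = ∑ k, (p k : ℂ) • ketBra (φ k)) (k : Fin r) (hk : p k ≠ 0) :
    ∃ a : D.K → ℂ, φ k = ∑ c, a c • D.v c := by
  classical
  refine ⟨fun c => star (D.v c) ⬝ᵥ φ k, ?_⟩
  set P : Matrix (A × B) (A × B) ℂ := ∑ c, ketBra (D.v c)
  have hPapply : ∀ ψ, P *ᵥ ψ = ∑ c, (star (D.v c) ⬝ᵥ ψ) • D.v c := by
    intro ψ
    rw [Matrix.sum_mulVec]
    refine Finset.sum_congr rfl fun c _ => ?_
    rw [ketBra, vecMulVec_mulVec]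
    simp
  have hPv : ∀ c, (1 - P) *ᵥ D.v c = 0 := by
    intro c
    rw [sub_mulVec, one_mulVec, hPapply]
    simp [D.star_dotProduct]
  have hzero : (1 - P) * ρ * (1 - P).conjTranspose = 0 := by
    rw [D.eq_sum, Matrix.mul_sum, Matrix.sum_mul]
    refine Finset.sum_eq_zero fun c _ => ?_
    rw [Matrix.mul_smul, Matrix.smul_mul, ← ketBra_mulVec, hPv]
    ext
    simp [ketBra_apply]
  have hφ : (1 - P) *ᵥ φ k = 0 := by
    rw [hρ, Matrix.mul_sum, Matrix.sum_mul] at hzero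
    simp_rw [Matrix.mul_smul, Matrix.smul_mul, ← ketBra_mulVec] at hzero
    ext x
    have hx := congrFun (congrFun hzero x) x
    simp only [Matrix.sum_apply, Matrix.smul_apply, ketBra_apply, smul_eq_mul, Complex.star_def,
      Complex.mul_conj', Matrix.zero_apply] at hx
    have hx' : ∑ k, p k * ‖((1 - P) *ᵥ φ k) x‖ ^ 2 = 0 := by exact_mod_cast hx
    have := (Finset.sum_eq_zero_iff_of_nonneg fun k _ =>
      mul_nonneg (hp k) (by positivity)).mp hx' k (Finset.mem_univ k)
    simpa [hk] using this
  rw [sub_mulVec, one_mulVec, sub_eq_zero] at hφ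
  rw [← hPapply]
  exact hφ

theorem le_roof (D : DiagonalEnsemble S ρ e) : e ≤ S.roof ρ := by
  -- The diagonal ensemble itself shows that the set of averages is nonempty.
  refine le_csInf ⟨_, ensemble_mem S.ent D.w_nonneg D.w_sum D.isUnitVec D.eq_sum⟩ ?_
  rintro v ⟨r, p, φ, hp, hp1, hφ, hρ, rfl⟩
  calc e = ∑ k, p k * e := by rw [← Finset.sum_mul, hp1, one_mul]
    _ ≤ _ := Finset.sum_le_sum fun k _ => ?_
  by_cases hk : p k = 0
  · simp [hk]
  · obtain ⟨a, ha⟩ := D.exists_eq_sum hp hρ k hk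
    exact mul_le_mul_of_nonneg_left (D.le_ent ha (hφ k)) (hp k)

/-- The diagonal ensemble of a pure state. -/
def ofPure (S : SpectralEntropy) {ψ : A × B → ℂ} (hψ : IsUnitVec ψ) :
    DiagonalEnsemble S (ketBra ψ) (S.ent ψ) where
  K := Unit
  fintypeK := inferInstance
  decEqK := inferInstance
  w _ := 1
  v _ := ψ
  W := (exists_reduced_eq ψ).choose
  d _ := (isHermitian_reduced ψ).eigenvalues
  w_nonneg _ := zero_le_one
  w_sum := by simp
  eq_sum := by simp
  unitary := (exists_reduced_eq ψ).choose_spec.1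
  cross _ _ := by
    rw [if_pos rfl]
    exact (exists_reduced_eq ψ).choose_spec.2
  d_nonneg _ := reduced_eigenvalues_nonneg ψ
  d_sum _ := reduced_eigenvalues_sum hψ
  entropy _ := rfl

/-- The diagonal ensemble of a mixture of distinct product basis vectors that are
distinguished by their second component. -/
def ofBasis (S : SpectralEntropy) {K : Type} [Fintype K] [DecidableEq K] [DecidableEq B]
    {w : K → ℝ} (hw : ∀ c, 0 ≤ w c) (hw1 : ∑ c, w c = 1) (x : K → A) {y : K → B}
    (hy : Function.Injective y) :
    DiagonalEnsemble S (∑ c, (w c : ℂ) • ketBra (Pi.single (x c, y c) (1 : ℂ))) 0 where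
  K := K
  fintypeK := inferInstance
  decEqK := inferInstance
  w := w
  v c := Pi.single (x c, y c) 1
  W := 1
  d c := Pi.single (x c) 1
  w_nonneg := hw
  w_sum := hw1
  eq_sum := rfl
  unitary := by simp
  cross c c' := by
    ext a a'
    have h : ∀ b, (Pi.single (x c, y c) 1 : A × B → ℂ) (a, b) *
        star ((Pi.single (x c', y c') 1 : A × B → ℂ) (a', b)) =
        if b = y c then (if c = c' ∧ a = x c ∧ a' = x c then 1 else 0) else 0 := by
      intro b
      simp only [Pi.single_apply, Prod.mk.injEq]
      by_cases hb : b = y c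
      · subst hb
        by_cases hc : c = c'
        · subst hc
          by_cases ha : a = x c <;> by_cases ha' : a' = x c <;> simp [ha, ha']
        · simp [hc, hy.ne hc]
      · simp [hb]
    simp only [traceRight, of_apply, vecMulVec_apply, Pi.star_apply, h]
    rw [Finset.sum_ite_eq', if_pos (Finset.mem_univ _)]
    by_cases hc : c = c'
    · subst hc
      by_cases haa : a = a'
      · subst haa
        by_cases ha : a = x c <;> simp [ha]
      · have : ¬(a = x c ∧ a' = x c) := fun h => haa (h.1.trans h.2.symm)
        simp [haa, this]
    · simp [hc]
  d_nonneg c a := by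
    by_cases h : a = x c
    · subst h
      simp
    · simp [h]
  d_sum c := by simp
  entropy c := by
    refine S.eq_zero _ (fun a => ?_) (by simp)
    by_cases h : a = x c
    · subst h
      simp
    · simp [h]

end DiagonalEnsemble

/-! ## Cuts and marginals -/

section Split

variable {n : ℕ} {L L' : Fin n → Type}

theorem piSplitAt_symm_map {α : Type} [DecidableEq α] {M M' : α → Type} (i : α)
    (F : ∀ k, M k → M' k) (x : M i) (y : ∀ k : {k // k ≠ i}, M k) :
    (fun k => F k ((Equiv.piSplitAt i M).symm (x, y) k)) =
      (Equiv.piSplitAt i M').symm (F i x, fun k => F k (y k)) := by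
  funext k
  by_cases h : k = i
  · subst h
    simp
  · simp [h]

theorem piMat_submatrix_piSplitAt {α : Type} [Fintype α] [DecidableEq α] {M : α → Type} (i : α)
    (V : ∀ k, Matrix (M k) (M k) ℂ) :
    (piMat V).submatrix (Equiv.piSplitAt i M).symm (Equiv.piSplitAt i M).symm =
      V i ⊗ₖ piMat fun k : {k // k ≠ i} => V k := by
  ext x y
  simp only [piMat, submatrix_apply, of_apply, kroneckerMap_apply]
  rw [Fintype.prod_eq_mul_prod_subtype_ne _ i]
  congr 1
  · simp
  · exact Finset.prod_congr rfl fun k _ => by simp [k.2]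

/-- The splitting of a basis index into the parts of `i`, of `j` and of the other parties. -/
def pairGlue (L : Fin n → Type) (i : Fin n) (j : {k // k ≠ i}) :
    (L i × L j) × (∀ k : {k : {k // k ≠ i} // k ≠ j}, L k) ≃ ∀ k, L k :=
  ((Equiv.prodAssoc _ _ _).trans (Equiv.prodCongr (Equiv.refl _)
    (Equiv.piSplitAt j fun k : {k // k ≠ i} => L k).symm)).trans (Equiv.piSplitAt i L).symm

theorem pairGlue_symm_apply (i : Fin n) (j : {k // k ≠ i}) (x : ∀ k, L k) :
    (pairGlue L i j).symm x = ((x i, x j), fun k : {k : {k // k ≠ i} // k ≠ j} => x k) := rfl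

theorem pairState_eq [∀ k, Fintype (L k)] (ρ : Matrix (∀ k, L k) (∀ k, L k) ℂ) (i : Fin n)
    (j : {k // k ≠ i}) :
    pairState ρ i j = traceRight (ρ.submatrix (pairGlue L i j) (pairGlue L i j)) := rfl

theorem cutState_conj [∀ k, Fintype (L k)] (V : ∀ k, Matrix (L k) (L k) ℂ)
    (ρ : Matrix (∀ k, L k) (∀ k, L k) ℂ) (i : Fin n) :
    cutState (piMat V * ρ * (piMat V).conjTranspose) i =
      (V i ⊗ₖ piMat fun k : {k // k ≠ i} => V k) * cutState ρ i *
        (V i ⊗ₖ piMat fun k : {k // k ≠ i} => V k).conjTranspose := by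
  rw [← piMat_submatrix_piSplitAt, conjTranspose_submatrix, cutState, cutState,
    submatrix_mul_equiv, submatrix_mul_equiv]

theorem pairState_conj [∀ k, Fintype (L k)] [∀ k, DecidableEq (L k)]
    {V : ∀ k, Matrix (L k) (L k) ℂ} (hV : ∀ k, (V k).conjTranspose * V k = 1)
    (ρ : Matrix (∀ k, L k) (∀ k, L k) ℂ) (i : Fin n) (j : {k // k ≠ i}) :
    pairState (piMat V * ρ * (piMat V).conjTranspose) i j =
      (V i ⊗ₖ V j) * pairState ρ i j * (V i ⊗ₖ V j).conjTranspose := by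
  have h : (piMat V).submatrix (pairGlue L i j) (pairGlue L i j) =
      (V i ⊗ₖ V j) ⊗ₖ piMat fun k : {k : {k // k ≠ i} // k ≠ j} => V k := by
    have h1 := piMat_submatrix_piSplitAt i V
    have h2 := piMat_submatrix_piSplitAt j fun k : {k // k ≠ i} => V k
    ext x y
    have e1 := congrFun (congrFun h1 (x.1.1, (Equiv.piSplitAt j fun k : {k // k ≠ i} => L k).symm
      (x.1.2, x.2))) (y.1.1, (Equiv.piSplitAt j fun k : {k // k ≠ i} => L k).symm (y.1.2, y.2))
    have e2 := congrFun (congrFun h2 (x.1.2, x.2)) (y.1.2, y.2)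
    simp only [submatrix_apply, kroneckerMap_apply] at e1 e2 ⊢
    rw [e2, ← mul_assoc] at e1
    exact e1
  rw [pairState_eq, pairState_eq, ← traceRight_kronecker_conj (V i ⊗ₖ V j)
    (piMat_conjTranspose_mul_self fun k : {k : {k // k ≠ i} // k ≠ j} => hV k), ← h,
    conjTranspose_submatrix, submatrix_mul_equiv, submatrix_mul_equiv]

variable [∀ k, Fintype (L k)] [∀ k, DecidableEq (L k)] {S : SpectralEntropy}

/-- When the other parties hold nothing, the trace has a single term and the pair state is the pure
cut state, up to relabelling. -/
theorem hasEnsembleLE_pairState_of_unique {ψ : (∀ k, L k) → ℂ} (hψ : IsUnitVec ψ) (i : Fin n)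
    (j : {k // k ≠ i}) [Unique (∀ k : {k : {k // k ≠ i} // k ≠ j}, L k)] :
    S.HasEnsembleLE (pairState (ketBra ψ) i j) (S.ent (ψ ∘ (Equiv.piSplitAt i L).symm)) := by
  let f : L j ≃ ∀ k : {k // k ≠ i}, L k :=
    (Equiv.prodUnique (L j) (∀ k : {k : {k // k ≠ i} // k ≠ j}, L k)).symm.trans
      (Equiv.piSplitAt j fun k : {k // k ≠ i} => L k).symm
  let φ : L i × L j → ℂ := (ψ ∘ (Equiv.piSplitAt i L).symm) ∘ (Equiv.refl (L i)).prodCongr f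
  refine ⟨Unit, inferInstance, fun _ => 1, fun _ => φ, fun _ => zero_le_one, by simp,
    fun _ => ?_, ?_, fun _ => (S.ent_comp_prodCongr _ f _).le⟩
  · rw [IsUnitVec, ← hψ]
    exact (((Equiv.refl (L i)).prodCongr f).trans (Equiv.piSplitAt i L).symm).sum_comp
      fun x => ‖ψ x‖ ^ 2
  · ext x y
    simp only [pairState, of_apply, Fintype.sum_unique, Complex.ofReal_one, one_smul]
    rfl

/-- Tracing out the other parties yields the ensemble of slices at fixed index `r`; product slices
make it separable. -/
theorem hasEnsembleLE_zero_pairState {K : Type} [Fintype K]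
    {ρ : Matrix (∀ k, L k) (∀ k, L k) ℂ} {ψ : K → (∀ k, L k) → ℂ}
    (hρ : ρ = ∑ c, ketBra (ψ c)) (hψ : ∑ c, ∑ x, ‖ψ c x‖ ^ 2 = 1) {i : Fin n}
    {j : {k // k ≠ i}} (h : ∀ c r, ∃ (a : L i → ℂ) (b : L j → ℂ),
      ∀ x y, ψ c (pairGlue L i j ((x, y), r)) = a x * b y) :
    S.HasEnsembleLE (pairState ρ i j) 0 := by
  refine SpectralEntropy.hasEnsembleLE_zero (K := K × ∀ k : {k : {k // k ≠ i} // k ≠ j}, L k)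
    (V := fun k z => ψ k.1 (pairGlue L i j (z, k.2))) ?_ ?_ fun k => h k.1 k.2
  · ext x y
    simp only [pairState_eq, traceRight, of_apply, submatrix_apply, hρ, Matrix.sum_apply,
      Fintype.sum_prod_type]
    exact Finset.sum_comm
  · rw [← hψ, Fintype.sum_prod_type]
    refine Finset.sum_congr rfl fun c _ => ?_
    rw [Finset.sum_comm, ← Fintype.sum_prod_type', (pairGlue L i j).sum_comp fun x => ‖ψ c x‖ ^ 2]

end Split

/-! ## Single resources -/

namespace Source

variable {n : ℕ}

/-- The index set of the product basis of the subsystems of a source that the party `k` holds. -/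
abbrev PartyBasis (T : Source n) (k : Fin n) : Type :=
  ∀ p : {p // T.owner p = k}, Fin (T.dim p)

/-- Regrouping the subsystems of a source by parties. -/
def assemble (T : Source n) : (∀ k, T.PartyBasis k) ≃ ∀ p, Fin (T.dim p) where
  toFun x p := x (T.owner p) ⟨p, rfl⟩
  invFun z _ p := z p
  left_inv x := by
    funext k p
    obtain ⟨p, rfl⟩ := p
    rfl
  right_inv _ := rfl

/-- The state of a source on the tensor product of the spaces of the parties. -/
def partyState (T : Source n) : Matrix (∀ k, T.PartyBasis k) (∀ k, T.PartyBasis k) ℂ :=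
  T.state.submatrix T.assemble T.assemble

/-- The part of a basis index of a source that belongs to the party `k`. -/
def part (T : Source n) (z : ∀ p, Fin (T.dim p)) (k : Fin n) : T.PartyBasis k :=
  fun p => z p.1

/-- The part of a basis index of a source that belongs to the parties other than `i` and `j`. -/
def restPart (T : Source n) (z : ∀ p, Fin (T.dim p)) (i : Fin n) (j : {k // k ≠ i}) :
    ∀ k : {k : {k // k ≠ i} // k ≠ j}, T.PartyBasis k :=
  fun k => T.part z k

theorem assemble_pairGlue_eq_iff (T : Source n) {i : Fin n} {j : {k // k ≠ i}}
    (x : T.PartyBasis i) (y : T.PartyBasis j)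
    (r : ∀ k : {k : {k // k ≠ i} // k ≠ j}, T.PartyBasis k) (z : ∀ p, Fin (T.dim p)) :
    T.assemble (pairGlue T.PartyBasis i j ((x, y), r)) = z ↔
      x = T.part z i ∧ y = T.part z j ∧ r = T.restPart z i j := by
  rw [← Equiv.eq_symm_apply, ← Equiv.eq_symm_apply, pairGlue_symm_apply, Prod.ext_iff,
    Prod.ext_iff, and_assoc]
  rfl

/-- The index `r` of the other parties is compatible with at most one of the two points, so at most
one point mass survives, and a point mass is a product. -/
theorem exists_product_of_two_points (T : Source n) {i : Fin n} {j : {k // k ≠ i}}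
    {z₀ z₁ : ∀ p, Fin (T.dim p)} (hne : T.restPart z₀ i j ≠ T.restPart z₁ i j) (α β : ℂ)
    (r : ∀ k : {k : {k // k ≠ i} // k ≠ j}, T.PartyBasis k) :
    ∃ (a : T.PartyBasis i → ℂ) (b : T.PartyBasis j → ℂ), ∀ x y,
      (if T.assemble (pairGlue T.PartyBasis i j ((x, y), r)) = z₀ then α else 0) +
        (if T.assemble (pairGlue T.PartyBasis i j ((x, y), r)) = z₁ then β else 0) =
          a x * b y := by
  simp only [assemble_pairGlue_eq_iff]
  by_cases hr : r = T.restPart z₀ i j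
  · have hr1 : ¬T.restPart z₀ i j = T.restPart z₁ i j := hne
    refine ⟨fun x => if x = T.part z₀ i then α else 0,
      fun y => if y = T.part z₀ j then 1 else 0, fun x y => ?_⟩
    by_cases hx : x = T.part z₀ i <;> by_cases hy : y = T.part z₀ j <;> simp [hx, hy, hr, hr1]
  · refine ⟨fun x => if x = T.part z₁ i ∧ r = T.restPart z₁ i j then β else 0,
      fun y => if y = T.part z₁ j then 1 else 0, fun x y => ?_⟩
    by_cases hx : x = T.part z₁ i <;> by_cases hy : y = T.part z₁ j <;> simp [hx, hy, hr]

theorem exists_bounds_of_pure (S : SpectralEntropy) {T : Source n}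
    {ψ : (∀ p, Fin (T.dim p)) → ℂ} (hψ : IsUnitVec ψ) (hT : T.state = ketBra ψ) (i : Fin n)
    (hprod : ∀ (j : {k // k ≠ i}), (∃ p, T.owner p = j) → ∀ q, T.owner q ≠ i → T.owner q ≠ j →
      ∀ r, ∃ (a : T.PartyBasis i → ℂ) (b : T.PartyBasis j → ℂ), ∀ x y,
        ψ (T.assemble (pairGlue T.PartyBasis i j ((x, y), r))) = a x * b y) :
    ∃ (e : ℝ) (c : {k // k ≠ i} → ℝ), Nonempty (DiagonalEnsemble S (cutState T.partyState i) e) ∧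
      ∑ j, c j ≤ e ∧ ∀ j, S.HasEnsembleLE (pairState T.partyState i j) (c j) := by
  classical
  have hT' : T.partyState = ketBra (ψ ∘ T.assemble) := by
    rw [partyState, hT]
    rfl
  have hψ' : IsUnitVec (ψ ∘ T.assemble) := by
    rw [IsUnitVec, ← hψ]
    exact T.assemble.sum_comp fun x => ‖ψ x‖ ^ 2
  set ψ' := ψ ∘ T.assemble
  have hcut : IsUnitVec (ψ' ∘ (Equiv.piSplitAt i T.PartyBasis).symm) := by
    rw [IsUnitVec, ← hψ']
    exact (Equiv.piSplitAt i T.PartyBasis).symm.sum_comp fun x => ‖ψ' x‖ ^ 2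
  set e := S.ent (ψ' ∘ (Equiv.piSplitAt i T.PartyBasis).symm)
  -- The second conjunct makes `j` unique: without it a resource held by `i` alone would be counted
  -- for every `j`.
  let C : {k // k ≠ i} → Prop := fun j =>
    (∀ p, T.owner p = i ∨ T.owner p = j) ∧ ∃ p, T.owner p = j
  refine ⟨e, fun j => if C j then e else 0, ⟨?_⟩, ?_, fun j => ?_⟩
  · rw [hT']
    exact DiagonalEnsemble.ofPure S hcut
  · have he : 0 ≤ e := S.ent_nonneg hcut
    rw [Finset.sum_ite, Finset.sum_const_zero, add_zero, Finset.sum_const, nsmul_eq_mul]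
    refine mul_le_of_le_one_left he ?_
    have : (Finset.univ.filter C).card ≤ 1 := by
      refine Finset.card_le_one.mpr fun j hj j' hj' => ?_
      obtain ⟨p, hp⟩ := (Finset.mem_filter.mp hj).2.2
      rcases (Finset.mem_filter.mp hj').2.1 p with h | h
      · exact absurd (hp.symm.trans h) j.2
      · exact Subtype.ext (hp.symm.trans h)
    exact_mod_cast this
  · rw [hT']
    have hzero : (∀ r, ∃ (a : T.PartyBasis i → ℂ) (b : T.PartyBasis j → ℂ), ∀ x y,
        ψ (T.assemble (pairGlue T.PartyBasis i j ((x, y), r))) = a x * b y) →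
        S.HasEnsembleLE (pairState (ketBra ψ') i j) 0 := fun h =>
      hasEnsembleLE_zero_pairState (K := Unit) (ψ := fun _ => ψ') (by simp)
        (by simpa [IsUnitVec] using hψ') fun _ => h
    by_cases hj : ∃ p, T.owner p = j
    · by_cases hall : ∀ p, T.owner p = i ∨ T.owner p = j
      · dsimp only
        rw [if_pos ⟨hall, hj⟩]
        have : ∀ k : {k : {k // k ≠ i} // k ≠ j}, IsEmpty {p // T.owner p = k} := fun k =>
          ⟨fun p => (hall p).elim (fun h => k.1.2 (p.2.symm.trans h))
            fun h => k.2 (Subtype.ext (p.2.symm.trans h))⟩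
        have : ∀ k : {k : {k // k ≠ i} // k ≠ j}, Unique (T.PartyBasis k) := fun k =>
          Pi.uniqueOfIsEmpty _
        exact hasEnsembleLE_pairState_of_unique hψ' i j
      · dsimp only
        rw [if_neg fun h => hall h.1]
        push Not at hall
        obtain ⟨q, hqi, hqj⟩ := hall
        exact hzero (hprod j hj q hqi hqj)
    · dsimp only
      rw [if_neg fun h => hj h.2]
      have : IsEmpty {p // T.owner p = j} := ⟨fun p => hj ⟨p, p.2⟩⟩
      -- Here `j` holds nothing, so its factor is one-dimensional.
      refine hzero fun r => ⟨fun x =>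
        ψ (T.assemble (pairGlue T.PartyBasis i j ((x, default), r))), fun _ => 1, fun x y => ?_⟩
      rw [mul_one, Subsingleton.elim y default]

end Source

theorem single_comp_equiv {X Y : Type} [DecidableEq X] [DecidableEq Y] (e : X ≃ Y) (z : Y) :
    (Pi.single z 1 : Y → ℂ) ∘ e = Pi.single (e.symm z) 1 := by
  funext x
  simp [Pi.single_apply, Equiv.eq_symm_apply]

theorem isUnitVec_ghzVec {m : ℕ} (hm : 3 ≤ m) (φ : ℝ) : IsUnitVec (ghzVec m φ) := by
  have hne : (fun _ : Fin m => (1 : Fin 2)) ≠ fun _ => 0 := fun h =>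
    absurd (congrFun h ⟨0, by omega⟩) (by decide)
  have h : ∀ c : Fin m → Fin 2, ‖ghzVec m φ c‖ ^ 2 =
      (if c = fun _ => 0 then Real.cos φ ^ 2 else 0) +
        (if c = fun _ => 1 then Real.sin φ ^ 2 else 0) := by
    intro c
    by_cases h0 : c = fun _ => 0
    · have h1 : c ≠ fun _ => 1 := fun h => hne (h.symm.trans h0)
      simp only [ghzVec, if_pos h0, if_neg h1, add_zero, Complex.norm_real, Real.norm_eq_abs,
        sq_abs]
    · by_cases h1 : c = fun _ => 1
      · simp only [ghzVec, if_neg h0, if_pos h1, zero_add, Complex.norm_real, Real.norm_eq_abs,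
          sq_abs]
      · simp [ghzVec, h0, h1]
  simp [IsUnitVec, h, Finset.sum_add_distrib]

theorem exists_bounds_delta (S : SpectralEntropy) {n : ℕ} {a b : Fin n} (hab : a ≠ b) (ϑ : ℝ)
    (i : Fin n) {T : Source n} (hT : T = ⟨2, fun _ => 2, ![a, b], deltaState ϑ⟩) :
    ∃ (e : ℝ) (c : {k // k ≠ i} → ℝ), Nonempty (DiagonalEnsemble S (cutState T.partyState i) e) ∧
      ∑ j, c j ≤ e ∧ ∀ j, S.HasEnsembleLE (pairState T.partyState i j) (c j) := by
  subst hT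
  set T : Source n := ⟨2, fun _ => 2, ![a, b], deltaState ϑ⟩
  let z : Fin 2 → ∀ p, Fin (T.dim p) := fun c _ => c
  have hcs : Real.cos ϑ ^ 2 + Real.sin ϑ ^ 2 = 1 := Real.cos_sq_add_sin_sq ϑ
  refine ⟨0, fun _ => 0, ⟨?_⟩, by simp, fun j => ?_⟩
  · let E := (Equiv.piSplitAt i T.PartyBasis).symm.trans T.assemble
    have hcut : cutState T.partyState i =
        ∑ c : Fin 2, ((![Real.cos ϑ ^ 2, Real.sin ϑ ^ 2] c : ℝ) : ℂ) •
          ketBra (Pi.single ((E.symm (z c)).1, (E.symm (z c)).2) (1 : ℂ)) := by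
      simp only [Prod.mk.eta, ← single_comp_equiv, Fin.sum_univ_two]
      rfl
    rw [hcut]
    refine DiagonalEnsemble.ofBasis S (fun c => ?_) (by simp) _ fun c c' h => ?_
    · fin_cases c
      · exact sq_nonneg (Real.cos ϑ)
      · exact sq_nonneg (Real.sin ϑ)
    -- As `a ≠ b`, some qubit lies outside `i`, and its value is the label `c`; this separates the
    -- second components.
    · obtain ⟨q, hq⟩ : ∃ q, T.owner q ≠ i := by
        by_cases hai : a = i
        · exact ⟨1, fun h : b = i => hab (hai.trans h.symm)⟩
        · exact ⟨0, hai⟩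
      exact congrFun (congrFun h ⟨T.owner q, hq⟩) ⟨q, rfl⟩
  · let g : Fin 2 → ℝ := ![Real.cos ϑ, Real.sin ϑ]
    have hρ : T.partyState =
        ∑ c : Fin 2, ketBra ((g c : ℂ) • (Pi.single (z c) 1 ∘ T.assemble)) := by
      have hg : ∀ t : ℝ, ((t ^ 2 : ℝ) : ℂ) = (t : ℂ) * star (t : ℂ) := fun t => by
        rw [Complex.star_def, Complex.conj_ofReal, ← Complex.ofReal_mul, sq]
      simp only [ketBra_smul, Fin.sum_univ_two, ← hg]
      rfl
    refine hasEnsembleLE_zero_pairState hρ ?_ fun c r => ?_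
    · simp only [single_comp_equiv, Fin.sum_univ_two, Pi.smul_apply, smul_eq_mul, norm_mul,
        mul_pow, ← Finset.mul_sum, Complex.norm_real, Real.norm_eq_abs, sq_abs, Pi.single_apply,
        apply_ite norm, norm_one, norm_zero, ite_pow, one_pow, ne_eq, OfNat.ofNat_ne_zero,
        not_false_eq_true, zero_pow, Finset.sum_ite_eq', Finset.mem_univ, if_true, mul_one]
      exact hcs
    · refine ⟨fun x => if x = T.part (z c) i ∧ r = T.restPart (z c) i j then (g c : ℂ) else 0,
        fun y => if y = T.part (z c) j then 1 else 0, fun x y => ?_⟩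
      simp only [Pi.smul_apply, Function.comp_apply, Pi.single_apply,
        Source.assemble_pairGlue_eq_iff, smul_eq_mul]
      by_cases hx : x = T.part (z c) i <;> by_cases hy : y = T.part (z c) j <;>
        by_cases hr : r = T.restPart (z c) i j <;> simp [hx, hy, hr]

theorem Resource.exists_bounds (S : SpectralEntropy) {n : ℕ} (r : Resource n) (i : Fin n) :
    ∃ (e : ℝ) (c : {k // k ≠ i} → ℝ),
      Nonempty (DiagonalEnsemble S (cutState r.toSource.partyState i) e) ∧
      ∑ j, c j ≤ e ∧ ∀ j, S.HasEnsembleLE (pairState r.toSource.partyState i j) (c j) := by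
  cases r with
  | twoPartyPure a b hab m d own hown ψ hψ =>
    refine Source.exists_bounds_of_pure S (T := ⟨m, d, own, ketBra ψ⟩) hψ rfl i ?_
    rintro j ⟨p, hp⟩ q hqi hqj r
    -- The holders of `p` and `q` are already the two parties of the resource, and neither is `i`.
    have : IsEmpty {p // own p = i} := by
      refine ⟨fun s => ?_⟩
      have hj := j.2
      have hs := s.2
      dsimp only at hp hqi hqj
      rcases hown p with h1 | h1 <;> rcases hown q with h2 | h2 <;>
        rcases hown s with h3 | h3 <;> grind
    refine ⟨fun _ => 1, fun y => ψ (Source.assemble _ (pairGlue _ i j ((default, y), r))),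
      fun x y => ?_⟩
    rw [one_mul, Subsingleton.elim x default]
  | ghz m hm φ own =>
    refine Source.exists_bounds_of_pure S (T := ⟨m, fun _ => 2, own, ketBra (ghzVec m φ)⟩)
      (isUnitVec_ghzVec hm φ) rfl i ?_
    rintro j - q hqi hqj r
    refine Source.exists_product_of_two_points ⟨m, fun _ => 2, own, ketBra (ghzVec m φ)⟩
      (z₀ := fun _ => (0 : Fin 2)) (z₁ := fun _ => (1 : Fin 2)) (fun h => ?_) _ _ r
    -- The qubit `q` outside `i` and `j` distinguishes the all-zero from the all-one branch.
    exact absurd (congrFun (congrFun h ⟨⟨own q, hqi⟩, fun h => hqj (congrArg Subtype.val h)⟩)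
      ⟨q, rfl⟩) zero_ne_one
  | delta a b hab ϑ => exact exists_bounds_delta S hab ϑ i rfl

/-! ## Networks -/

section Networks

variable {n N : ℕ} (R : Fin N → Resource n)

/-- Regrouping the subsystems of a party by resources. -/
def localEquiv (k : Fin n) : LocalBasis R k ≃ ∀ s, (R s).toSource.PartyBasis k where
  toFun x s p := x ⟨⟨s, p.1⟩, p.2⟩
  invFun y q := y q.1.1 ⟨q.1.2, q.2⟩
  left_inv _ := rfl
  right_inv _ := rfl

/-- Regrouping the subsystems of several parties by resources. -/
def groupEquiv {ι : Type} (k : ι → Fin n) :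
    (∀ t, LocalBasis R (k t)) ≃ ∀ s, ∀ t, (R s).toSource.PartyBasis (k t) :=
  (Equiv.piCongrRight fun t => localEquiv R (k t)).trans (Equiv.piComm _)

theorem cutState_sourceState (i : Fin n) :
    cutState (sourceState R) i =
      (piState fun s => cutState (R s).toSource.partyState i).submatrix
        ((localEquiv R i).prodCongr (groupEquiv R Subtype.val))
        ((localEquiv R i).prodCongr (groupEquiv R Subtype.val)) := by
  have h : ∀ (x : LocalBasis R i) (y : ∀ k : {k // k ≠ i}, LocalBasis R k) (s : Fin N),
      resourceIndex R ((Equiv.piSplitAt i (LocalBasis R)).symm (x, y)) s =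
        (R s).toSource.assemble ((Equiv.piSplitAt i (R s).toSource.PartyBasis).symm
          (localEquiv R i x s, fun k => localEquiv R k (y k) s)) := by
    intro x y s
    rw [← piSplitAt_symm_map i fun k (x : LocalBasis R k) => localEquiv R k x s]
    rfl
  ext ⟨x, y⟩ ⟨x', y'⟩
  simp only [cutState, submatrix_apply, sourceState, of_apply, h]
  rfl

theorem pairState_sourceState (i : Fin n) (j : {k // k ≠ i}) :
    pairState (sourceState R) i j =
      (piState fun s => pairState (R s).toSource.partyState i j).submatrix
        ((localEquiv R i).prodCongr (localEquiv R j))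
        ((localEquiv R i).prodCongr (localEquiv R j)) := by
  have h : ∀ (x : LocalBasis R j) (r : ∀ k : {k : {k // k ≠ i} // k ≠ j}, LocalBasis R k)
      (s : Fin N), (groupEquiv R Subtype.val
        ((Equiv.piSplitAt j fun k : {k // k ≠ i} => LocalBasis R k).symm (x, r))) s =
      (Equiv.piSplitAt j fun k : {k // k ≠ i} => (R s).toSource.PartyBasis k).symm
        (localEquiv R j x s, groupEquiv R (fun k : {k : {k // k ≠ i} // k ≠ j} => k.1.1) r s) :=
    fun x r s => piSplitAt_symm_map j (fun k (x : LocalBasis R k.1) => localEquiv R k x s) x r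
  ext ⟨x, x'⟩ ⟨y, y'⟩
  simp only [pairState, cutState_sourceState, submatrix_apply, of_apply, piState,
    Equiv.prodCongr_apply, Prod.map, h]
  -- The partial trace of a tensor product factorizes: a product of sums is a sum over families of
  -- indices, regrouped from parties to resources.
  rw [Fintype.prod_sum, ← (groupEquiv R fun k : {k : {k // k ≠ i} // k ≠ j} => k.1.1).sum_comp]

variable {R}

theorem networkState_eq (U : ∀ i, Matrix.unitaryGroup (LocalBasis R i) ℂ) :
    networkState U = piMat (fun k => (U k : Matrix (LocalBasis R k) (LocalBasis R k) ℂ)) *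
      sourceState R *
        (piMat fun k => (U k : Matrix (LocalBasis R k) (LocalBasis R k) ℂ)).conjTranspose :=
  rfl

theorem unitaryGroup_conjTranspose_mul_self {X : Type} [Fintype X] [DecidableEq X]
    (V : Matrix.unitaryGroup X ℂ) : (V : Matrix X X ℂ).conjTranspose * V = 1 :=
  Unitary.coe_star_mul_self V

theorem SpectralEntropy.sum_roof_pairState_le (S : SpectralEntropy)
    (U : ∀ i, Matrix.unitaryGroup (LocalBasis R i) ℂ) (i : Fin n) :
    ∑ j : {k // k ≠ i}, S.roof (pairState (networkState U) i j) ≤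
      S.roof (cutState (networkState U) i) := by
  choose e c D hc hle using fun s => (R s).exists_bounds S i
  have hU : ∀ k, (U k : Matrix (LocalBasis R k) (LocalBasis R k) ℂ).conjTranspose * U k = 1 :=
    fun k => unitaryGroup_conjTranspose_mul_self (U k)
  have hcut : S.roof (cutState (networkState U) i) =
      S.roof (piState fun s => cutState (R s).toSource.partyState i) := by
    rw [networkState_eq, cutState_conj, S.roof_kronecker_conj (hU i)
      (piMat_conjTranspose_mul_self fun k : {k // k ≠ i} => hU k), cutState_sourceState,
      S.roof_submatrix]
  have hpair : ∀ j, S.roof (pairState (networkState U) i j) =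
      S.roof (piState fun s => pairState (R s).toSource.partyState i j) := by
    intro j
    rw [networkState_eq, pairState_conj hU, S.roof_kronecker_conj (hU i) (hU j),
      pairState_sourceState, S.roof_submatrix]
  simp_rw [hcut, hpair]
  calc _ ≤ ∑ j, ∑ s, c s j := Finset.sum_le_sum fun j _ =>
        (SpectralEntropy.HasEnsembleLE.piState fun s => hle s j).roof_le
    _ = ∑ s, ∑ j, c s j := Finset.sum_comm
    _ ≤ ∑ s, e s := Finset.sum_le_sum fun s _ => hc s
    _ ≤ _ := (DiagonalEnsemble.pi fun s => (D s).some).le_roof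

end Networks

end

end QNetwork

theorem theoremS3 {n N : ℕ} (R : Fin N → QNetwork.Resource n)
    (U : ∀ i, Matrix.unitaryGroup (QNetwork.LocalBasis R i) ℂ) (i : Fin n) :
    (∑ j : {k // k ≠ i}, QNetwork.eof (QNetwork.pairState (QNetwork.networkState U) i j) ≤
      QNetwork.eof (QNetwork.cutState (QNetwork.networkState U) i)) ∧
    ∀ α : ℝ, 0 < α → α ≠ 1 →
      ∑ j : {k // k ≠ i},
          QNetwork.renyiEntanglement α (QNetwork.pairState (QNetwork.networkState U) i j) ≤
        QNetwork.renyiEntanglement α (QNetwork.cutState (QNetwork.networkState U) i) :=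
  ⟨QNetwork.vonNeumann.sum_roof_pairState_le U i,
    fun α hα hα1 => (QNetwork.renyi α hα hα1).sum_roof_pairState_le U i⟩
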